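/- **Recursion for the Betti numbers of generalized multi-state $k$-out-of-$n$ systems.** Let $\mathbf k$ be a field. For integers $n,k\ge 0$ and $i\ge 1$ let $I_{(k,n),i}\subseteq \mathbf k[x_1,\dots,x_n]$ be the ideal generated by the monomials $\prod_{c\in\sigma}x_c^{\,i}$, $\sigma\subseteq\{1,\dots,n\}$, $|\sigma|=k$. For $1\le j\le M$ and positive integers $k_j>k_{j+1}>\dots>k_M$ let $$I_{n,(k_j,\dots,k_M)}=\sum_{i=j}^{M}I_{(k_i,n),i}$$ be the $j$-reliability ideal of the generalized multi-state $k$-out-of-$n$ system; put $I_{n,(k_j,\dots,k_{M-1})}=0$ if $M=j$. In the smaller ideals below, a threshold that becomes negative is read as $0$ (so that the ideal is the whole ring as soon as one threshold is $\le 0$). Let the states of the components be independent and identically distributed with values in $\{0,1,2,\dots\}$, and let $p_{\ge l}$ be the probability that a component is in state $l$ or above. For a monomial ideal $I\subseteq\mathbf k[x_1,\dots,x_n]$ let $\beta_{a,\mu}(I)$ be the number of basis elements of multidegree $\mu\in\mathbb N^n$ in the $a$-th free module of the minimal multigraded free resolution $\cdots\to F_1\to F_0\to I\to 0$, and let $$\beta_a(I)=\sum_{\mu}\beta_{a,\mu}(I)\prod_{c=1}^{n}p_{\ge\mu_c}$$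 be the $a$-th Betti number in which each basis element is weighted with the probability of its monomial. Then for every integer $\alpha\ge 0$ $$\begin{aligned} \beta_\alpha(I_{n,(k_j,\dots,k_M)})={}&\beta_\alpha(I_{n,(k_j,\dots,k_{M-1})})\\ &+\sum_{\substack{0\le i\le n-k_M-2\\ i\le \alpha-2}}\binom{n}{k_M+i}\binom{i+k_M-1}{k_M-1}p_{\ge M}^{\,k_M+i}\,\beta_{\alpha-i-1}\bigl(I_{n-k_M-i,(k_j-k_M-i,\dots,k_{M-1}-k_M-i)}\bigr)\\ &+\varepsilon_{\alpha-1}\binom{n}{k_M+\alpha-1}\binom{\alpha+k_M-2}{k_M-1}p_{\ge M}^{\,k_M+\alpha-1}\sum_{l=j}^{M-1}\binom{n-k_M-(\alpha-1)}{k_l-k_M-(\alpha-1)}p_{\ge l}^{\,k_l-k_M-(\alpha-1)}\\ &+\varepsilon_{\alpha}\,p_{\ge M}^{\,k_M+\alpha}\sum_{i=0}^{n-k_M}\binom{i+k_M-1}{k_M-1}\binom{i}{\alpha}, \end{aligned}$$ where, for an integer $s$, $\varepsilon_s=1$ if $s\ge 0$ and all thresholds $k_l-k_M-s$ $(j\le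 l\le M-1)$ are positive, and $\varepsilon_s=0$ otherwise; a term with $\varepsilon_s=0$ is absent, and so is the last sum if $k_M>n$. -/

import Mathlib

open MeasureTheory

namespace MultiState

noncomputable section

/-- The ideal `I_{(k,n),i}` of `K[x_1,…,x_n]`, generated by the monomials `∏_{c ∈ σ} x_c ^ i`,
where `σ` runs over the `k`-element subsets of the set of the `n` components. -/
def simpleIdeal (K : Type*) [Field K] (n k i : ℕ) : Ideal (MvPolynomial (Fin n) K) :=
  Ideal.span {f | ∃ σ : Finset (Fin n), σ.card = k ∧ f = ∏ c ∈ σ, MvPolynomial.X c ^ i}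

/-- The `j`-reliability ideal `I_{n,(k_j,…,k_M)} = ∑_{i=j}^{M} I_{(k_i,n),i}` of the generalized
multi-state `k`-out-of-`n` system with thresholds `k i` (the zero ideal if there is no level `i`
with `j ≤ i ≤ M`). -/
def reliabilityIdeal (K : Type*) [Field K] (n : ℕ) (k : ℕ → ℕ) (j M : ℕ) :
    Ideal (MvPolynomial (Fin n) K) :=
  ∑ i ∈ Finset.Icc j M, simpleIdeal K n (k i) i

/-- A minimal `ℕⁿ`-graded free resolution
`⋯ → F₂ → F₁ → F₀ → I → 0` of an ideal `I` of `R = K[x_1,…,x_n]`, by free `R`-modules of finite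
rank. The `b`-th basis element of `F_a` has multidegree `deg a b`. -/
structure MinimalFreeResolution {K : Type*} [Field K] {n : ℕ}
    (I : Ideal (MvPolynomial (Fin n) K)) where
  /-- the rank of `F_a` -/
  rank : ℕ → ℕ
  /-- the multidegrees of the basis elements of `F_a` -/
  deg : (a : ℕ) → Fin (rank a) → (Fin n →₀ ℕ)
  /-- the augmentation `F₀ → R`, whose image is `I` -/
  aug : (Fin (rank 0) → MvPolynomial (Fin n) K) →ₗ[MvPolynomial (Fin n) K]
    MvPolynomial (Fin n) K
  /-- the differentials `F_{a+1} → F_a` -/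
  d : (a : ℕ) → (Fin (rank (a + 1)) → MvPolynomial (Fin n) K) →ₗ[MvPolynomial (Fin n) K]
    (Fin (rank a) → MvPolynomial (Fin n) K)
  range_aug : LinearMap.range aug = I
  exact_zero : Function.Exact (d 0) aug
  exact_succ : ∀ a, Function.Exact (d (a + 1)) (d a)
  /-- the augmentation is homogeneous of multidegree `0` -/
  aug_homogeneous : ∀ b, ∀ m ∈ (aug (Pi.single b 1)).support, m = deg 0 b
  /-- the differentials are homogeneous of multidegree `0` -/
  d_homogeneous : ∀ a b b', ∀ m ∈ (d a (Pi.single b 1) b').support, m + deg a b' = deg (a + 1) b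
  /-- minimality: the entries of the differentials lie in the maximal ideal `(x_1,…,x_n)` -/
  minimal : ∀ a b b', MvPolynomial.constantCoeff (d a (Pi.single b 1) b') = 0

open Classical in
/-- The multigraded Betti number `β_{a,μ}(I)`: the number of basis elements of multidegree `μ` in
the `a`-th free module of the minimal free resolution of `I`. -/
def multigradedBetti {K : Type*} [Field K] {n : ℕ} (I : Ideal (MvPolynomial (Fin n) K))
    (a : ℕ) (μ : Fin n →₀ ℕ) : ℕ :=
  if h : Nonempty (MinimalFreeResolution I) then
    Fintype.card {b : Fin (h.some.rank a) // h.some.deg a b = μ}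
  else 0

/-- `p_{≥ l}`: the probability that a component is performing at level `l` or above, where `P` is
the distribution of its state. -/
def levelProb (P : Measure ℕ) (l : ℕ) : ℝ := P.real (Set.Ici l)

/-- The Betti number `β_a(I)` in the form used for independent, identically distributed
components: each basis element of multidegree `μ` of the `a`-th module of the minimal resolution
contributes the probability `∏_c p_{≥ μ_c}` of the monomial `x^μ`. -/
def weightedBetti {K : Type*} [Field K] {n : ℕ} (P : Measure ℕ)
    (I : Ideal (MvPolynomial (Fin n) K)) (a : ℕ) : ℝ :=
  ∑ᶠ μ : Fin n →₀ ℕ, (multigradedBetti I a μ : ℝ) * ∏ c, levelProb P (μ c)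

end

end MultiState

/-! The Betti number of a monomial ideal in multidegree `μ` is the dimension of the homology of its
Koszul complex in that degree, whose faces are the sets `τ` with `x^μ / ∏_{c ∈ τ} x_c` still in the
ideal. Homology is indexed by the cardinality of faces, so no shift appears between Betti degree and
`homDim`. This is `multigradedBetti_eq_homDim`. It rests on dimension shifting along any minimal
resolution (`MinimalFreeResolution.card_deg_eq`) and on existence
(`nonempty_minimalFreeResolution`). Modules are dehomogenized to monotone families of subspaces of
finite-dimensional `K`-spaces.

For the reliability ideal, fix `ν` with entries at most `M`. Let `A` be the set where `ν = M` and
`B` the set where `0 < ν < M`. Lowering a component of `A` by one spoils only the test at level `M`,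
so the Koszul complex is the union of (skeleton of `A`) * (simplex on `B`) and (simplex on `A`) *
`Y`. Here `Y` is the Koszul complex of the lower levels on the components outside `A`, with
thresholds reduced by `|A|` (`koszulFace_iff_joinFace`). Its homology is `(|A|-1).choose (k M - 1)`
copies of that of the pair (simplex on `B`, `Y`), shifted by `|A| - k M` (`homDim_joinFace_succ`),
and the pair computes Betti numbers of the quotient ring of the smaller system
(`reliabilityBetti_of_top`).

Summing over degrees grouped by `A` gives `weightedBetti_recursion`: `A = ∅` yields the system
without level `M`, and sets of size `k M + i` yield the quotient Betti numbers in degree `α - i`.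
Quotient degrees at least two, one and zero are respectively higher Betti numbers of the smaller
ideal, its minimal generators, and the generator `1` of the quotient. These are the three remaining
terms of the formula, the last one rewritten by `sum_choose_mul_choose`. -/

namespace MultiState

set_option linter.unusedSectionVars false

/-! ### The Koszul differential and the cone homotopy -/

section Koszul

variable {ι : Type*} [LinearOrder ι]

/-- The sign of inserting `c` into `τ`: one factor `-1` for each element of `τ` below `c`. -/
def insertSign (K : Type*) [Field K] (c : ι) (τ : Finset ι) : K :=
  ∏ x ∈ τ, if x < c then -1 else 1

variable {K : Type*} [Field K]

theorem insertSign_mul_self (c : ι) (τ : Finset ι) :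
    insertSign K c τ * insertSign K c τ = 1 := by
  unfold insertSign
  rw [← Finset.prod_mul_distrib]
  apply Finset.prod_eq_one
  intro x _
  split_ifs <;> simp

theorem insertSign_insert {c x : ι} {τ : Finset ι} (hx : x ∉ τ) :
    insertSign K c (insert x τ) = (if x < c then -1 else 1) * insertSign K c τ := by
  unfold insertSign
  rw [Finset.prod_insert hx]

/-- Exactly one of the two vertices lies below the other, so exchanging the order of insertion costs
one factor `-1`. This is the source of all anticommutation below. -/
theorem insertSign_swap {a c : ι} (hac : a ≠ c) {τ : Finset ι} (ha : a ∉ τ) (hc : c ∉ τ) :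
    insertSign K a τ * insertSign K c (insert a τ) =
      -(insertSign K c τ * insertSign K a (insert c τ)) := by
  rw [insertSign_insert ha, insertSign_insert hc]
  rcases lt_or_gt_of_ne hac with h | h
  · rw [if_pos h, if_neg h.not_gt]; ring
  · rw [if_neg h.not_gt, if_pos h]; ring

variable {V W : Type*} [AddCommGroup V] [Module K V] [AddCommGroup W] [Module K W]

/-- The contraction with the vertex `c` of a family of coefficients indexed by finite sets. -/
def contract (K : Type*) [Field K] [Module K V] (c : ι) :
    (Finset ι → V) →ₗ[K] (Finset ι → V) where
  toFun f τ := if c ∈ τ then 0 else insertSign K c τ • f (insert c τ)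
  map_add' f g := by
    ext τ
    by_cases h : c ∈ τ <;> simp [h]
  map_smul' r f := by
    ext τ
    by_cases h : c ∈ τ <;> simp [h, smul_comm r]

/-- The cone operator with apex `a`. -/
def wedge (K : Type*) [Field K] [Module K V] (a : ι) :
    (Finset ι → V) →ₗ[K] (Finset ι → V) where
  toFun f τ := if a ∈ τ then insertSign K a (τ.erase a) • f (τ.erase a) else 0
  map_add' f g := by
    ext τ
    by_cases h : a ∈ τ <;> simp [h]
  map_smul' r f := by
    ext τ
    by_cases h : a ∈ τ <;> simp [h, smul_comm r]

theorem contract_apply_of_mem {c : ι} {τ : Finset ι} (h : c ∈ τ) (f : Finset ι → V) :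
    contract K c f τ = 0 := if_pos h

theorem contract_apply_of_notMem {c : ι} {τ : Finset ι} (h : c ∉ τ) (f : Finset ι → V) :
    contract K c f τ = insertSign K c τ • f (insert c τ) := if_neg h

theorem wedge_apply_of_notMem {a : ι} {τ : Finset ι} (h : a ∉ τ) (f : Finset ι → V) :
    wedge K a f τ = 0 := if_neg h

theorem wedge_apply_of_mem {a : ι} {τ : Finset ι} (h : a ∈ τ) (f : Finset ι → V) :
    wedge K a f τ = insertSign K a (τ.erase a) • f (τ.erase a) := if_pos h

theorem wedge_apply_insert {a : ι} {τ : Finset ι} (h : a ∉ τ) (f : Finset ι → V) :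
    wedge K a f (insert a τ) = insertSign K a τ • f τ := by
  rw [wedge_apply_of_mem (Finset.mem_insert_self a τ), Finset.erase_insert h]

theorem contract_contract_self (c : ι) (f : Finset ι → V) :
    contract K c (contract K c f) = 0 := by
  ext τ
  by_cases h : c ∈ τ
  · rw [contract_apply_of_mem h]; rfl
  · rw [contract_apply_of_notMem h, contract_apply_of_mem (Finset.mem_insert_self c τ)]; simp

theorem contract_contract_swap {a c : ι} (hac : a ≠ c) (f : Finset ι → V) :
    contract K a (contract K c f) + contract K c (contract K a f) = 0 := by
  ext τ
  rw [Pi.add_apply, Pi.zero_apply]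
  by_cases ha : a ∈ τ
  · rw [contract_apply_of_mem ha]
    by_cases hc : c ∈ τ
    · rw [contract_apply_of_mem hc, add_zero]
    · rw [contract_apply_of_notMem hc, contract_apply_of_mem (Finset.mem_insert_of_mem ha)]
      simp
  · by_cases hc : c ∈ τ
    · rw [contract_apply_of_notMem ha, contract_apply_of_mem hc,
        contract_apply_of_mem (Finset.mem_insert_of_mem hc)]
      simp
    · have h1 : c ∉ insert a τ := by simp [hc, hac.symm]
      have h2 : a ∉ insert c τ := by simp [ha, hac]
      rw [contract_apply_of_notMem ha, contract_apply_of_notMem hc, contract_apply_of_notMem h1,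
        contract_apply_of_notMem h2, smul_smul, smul_smul, insertSign_swap hac ha hc,
        Finset.insert_comm c a τ, neg_smul, neg_add_cancel]

/-- On sets containing `a` only the second summand survives, on the others only the first, and in
both the sign occurs squared. Together with `contract_wedge_add_of_ne` these are the Clifford
relations. -/
theorem contract_wedge_self_add (a : ι) (f : Finset ι → V) :
    contract K a (wedge K a f) + wedge K a (contract K a f) = f := by
  ext τ
  rw [Pi.add_apply]
  by_cases ha : a ∈ τ
  · rw [contract_apply_of_mem ha, wedge_apply_of_mem ha,
      contract_apply_of_notMem (Finset.notMem_erase a τ), smul_smul, insertSign_mul_self,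
      Finset.insert_erase ha, one_smul, zero_add]
  · rw [contract_apply_of_notMem ha, wedge_apply_insert ha, wedge_apply_of_notMem ha, smul_smul,
      insertSign_mul_self, one_smul, add_zero]

theorem contract_wedge_add_of_ne {a c : ι} (hac : a ≠ c) (f : Finset ι → V) :
    contract K c (wedge K a f) + wedge K a (contract K c f) = 0 := by
  ext τ
  rw [Pi.add_apply, Pi.zero_apply]
  by_cases hc : c ∈ τ
  · rw [contract_apply_of_mem hc, zero_add]
    by_cases ha : a ∈ τ
    · rw [wedge_apply_of_mem ha, contract_apply_of_mem (Finset.mem_erase.2 ⟨hac.symm, hc⟩),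
        smul_zero]
    · rw [wedge_apply_of_notMem ha]
  · by_cases ha : a ∈ τ
    · obtain ⟨σ, hσ, rfl⟩ : ∃ σ, a ∉ σ ∧ insert a σ = τ :=
        ⟨τ.erase a, Finset.notMem_erase a τ, Finset.insert_erase ha⟩
      have hcσ : c ∉ σ := fun h => hc (Finset.mem_insert_of_mem h)
      have h2 : a ∉ insert c σ := by simp [hσ, hac]
      rw [contract_apply_of_notMem hc, Finset.insert_comm, wedge_apply_insert h2,
        wedge_apply_insert hσ, contract_apply_of_notMem hcσ, smul_smul, smul_smul, ← add_smul]
      have h3 := insertSign_swap (K := K) hac hσ hcσ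
      have e1 := insertSign_mul_self (K := K) a σ
      have e2 := insertSign_mul_self (K := K) a (insert c σ)
      -- Signs are their own inverses, so this is `insertSign_swap` multiplied through by
      -- `insertSign K a σ` and `insertSign K a (insert c σ)`.
      have : insertSign K c (insert a σ) * insertSign K a (insert c σ)
          + insertSign K a σ * insertSign K c σ = 0 := by
        linear_combination
          (insertSign K a σ * insertSign K a (insert c σ)) * h3
          - insertSign K c (insert a σ) * insertSign K a (insert c σ) * e1
          - insertSign K a σ * insertSign K c σ * e2
      rw [this, zero_smul]
    · have h1 : a ∉ insert c τ := by simp [ha, hac]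
      rw [contract_apply_of_notMem hc, wedge_apply_of_notMem h1, wedge_apply_of_notMem ha]
      simp

variable [Fintype ι]

/-- The simplicial boundary (the Koszul differential). -/
def boundary (K : Type*) [Field K] [Module K V] : (Finset ι → V) →ₗ[K] (Finset ι → V) :=
  ∑ c : ι, contract K c

theorem boundary_apply (f : Finset ι → V) : boundary K f = ∑ c : ι, contract K c f := by
  simp [boundary]

theorem boundary_boundary (f : Finset ι → V) : boundary K (boundary K f) = 0 := by
  simp only [boundary_apply, map_sum]
  rw [← Finset.sum_product']
  -- Exchanging the two removed vertices pairs terms that cancel; the fixed points of the involution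
  -- are already zero.
  refine Finset.sum_involution (fun p _ => (p.2, p.1)) ?_ ?_ ?_ ?_
  · rintro ⟨a, c⟩ _
    by_cases h : a = c
    · subst h; simp [contract_contract_self]
    · exact contract_contract_swap (Ne.symm h) f
  · rintro ⟨a, c⟩ _ h0 h1
    obtain rfl : c = a := congrArg Prod.fst h1
    exact h0 (contract_contract_self _ _)
  · simp
  · simp

/-- Coning with `a` is a chain homotopy from the identity to zero, because all Clifford cross terms
cancel. Every acyclicity statement below comes from this formula. -/
theorem boundary_wedge_add (a : ι) (f : Finset ι → V) :
    boundary K (wedge K a f) + wedge K a (boundary K f) = f := by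
  simp only [boundary_apply, map_sum]
  rw [← Finset.sum_add_distrib, Finset.sum_eq_single a]
  · exact contract_wedge_self_add a f
  · intro c _ h; exact contract_wedge_add_of_ne h.symm f
  · simp

theorem boundary_contract_add (a : ι) (f : Finset ι → V) :
    boundary K (contract K a f) + contract K a (boundary K f) = 0 := by
  simp only [boundary_apply, map_sum]
  rw [← Finset.sum_add_distrib]
  apply Finset.sum_eq_zero
  intro c _
  by_cases h : c = a
  · subst h; simp [contract_contract_self]
  · exact contract_contract_swap h f

theorem contract_compLeft (φ : V →ₗ[K] W) (c : ι) (f : Finset ι → V) :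
    contract K c (φ.compLeft (Finset ι) f) = φ.compLeft (Finset ι) (contract K c f) := by
  ext τ
  by_cases h : c ∈ τ
  · simp [contract_apply_of_mem h]
  · simp [contract_apply_of_notMem h]

theorem boundary_compLeft (φ : V →ₗ[K] W) (f : Finset ι → V) :
    boundary K (φ.compLeft (Finset ι) f) = φ.compLeft (Finset ι) (boundary K f) := by
  simp only [boundary_apply, map_sum, contract_compLeft]

/-- The `i`-chains with coefficient in `D τ` at the set `τ`. -/
def chains (D : Finset ι → Submodule K V) (i : ℕ) : Submodule K (Finset ι → V) where
  carrier := {f | ∀ τ, f τ ∈ D τ ∧ (τ.card ≠ i → f τ = 0)}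
  add_mem' hf hg τ := ⟨add_mem (hf τ).1 (hg τ).1, fun h => by
    simp [(hf τ).2 h, (hg τ).2 h]⟩
  zero_mem' τ := ⟨zero_mem _, fun _ => rfl⟩
  smul_mem' r f hf τ := ⟨Submodule.smul_mem _ _ (hf τ).1, fun h => by simp [(hf τ).2 h]⟩

/-- The `i`-cycles. -/
def cycles (D : Finset ι → Submodule K V) (i : ℕ) : Submodule K (Finset ι → V) :=
  chains D i ⊓ LinearMap.ker (boundary K)

/-- The `i`-boundaries. -/
def bdries (D : Finset ι → Submodule K V) (i : ℕ) : Submodule K (Finset ι → V) :=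
  (chains D (i + 1)).map (boundary K)

/-- The dimension of the `i`-th homology of the complex of chains with coefficients in `D`. -/
noncomputable def homDim (D : Finset ι → Submodule K V) (i : ℕ) : ℤ :=
  (Module.finrank K (cycles D i) : ℤ) - Module.finrank K (bdries D i)

variable {D E : Finset ι → Submodule K V}

theorem contract_mem_chains (hD : Antitone D) {i : ℕ} {f : Finset ι → V} (c : ι)
    (hf : f ∈ chains D (i + 1)) : contract K c f ∈ chains D i := by
  intro τ
  by_cases h : c ∈ τ
  · simp [contract_apply_of_mem h]
  · rw [contract_apply_of_notMem h]
    refine ⟨Submodule.smul_mem _ _ (hD (Finset.subset_insert c τ) (hf _).1), fun h2 => ?_⟩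
    rw [(hf (insert c τ)).2, smul_zero]
    rw [Finset.card_insert_of_notMem h]
    omega

theorem boundary_mem_chains (hD : Antitone D) {i : ℕ} {f : Finset ι → V}
    (hf : f ∈ chains D (i + 1)) : boundary K f ∈ chains D i := by
  rw [boundary_apply]
  exact Submodule.sum_mem _ fun c _ => contract_mem_chains hD c hf

theorem boundary_eq_zero_of_mem_chains_zero {f : Finset ι → V} (hf : f ∈ chains D 0) :
    boundary K f = 0 := by
  rw [boundary_apply]
  refine Finset.sum_eq_zero fun c _ => ?_
  ext τ
  by_cases h : c ∈ τ
  · simp [contract_apply_of_mem h]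
  · rw [contract_apply_of_notMem h, (hf (insert c τ)).2, smul_zero, Pi.zero_apply]
    rw [Finset.card_insert_of_notMem h]
    omega

theorem cycles_zero : cycles D 0 = chains D 0 :=
  inf_eq_left.2 fun _ hf => boundary_eq_zero_of_mem_chains_zero hf

theorem bdries_le_cycles (hD : Antitone D) (i : ℕ) : bdries D i ≤ cycles D i := by
  rintro _ ⟨f, hf, rfl⟩
  exact ⟨boundary_mem_chains hD hf, boundary_boundary f⟩

theorem wedge_mem_chains {a : ι} (h : ∀ τ, a ∉ τ → E τ ≤ D (insert a τ)) {i : ℕ}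
    {f : Finset ι → V} (hf : f ∈ chains E i) : wedge K a f ∈ chains D (i + 1) := by
  intro τ
  by_cases ha : a ∈ τ
  · have h1 := Finset.card_erase_add_one ha
    rw [wedge_apply_of_mem ha]
    have h2 := h _ (Finset.notMem_erase a τ) (hf (τ.erase a)).1
    rw [Finset.insert_erase ha] at h2
    refine ⟨Submodule.smul_mem _ _ h2, fun h3 => ?_⟩
    rw [(hf (τ.erase a)).2 (by omega), smul_zero]
  · simp [wedge_apply_of_notMem ha]

/-- A cycle is the boundary of its cone. The cycles and the cones may live in different complexes
`E` and `D`, which is what the splitting of the vertex sequence needs. -/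
theorem cycles_le_bdries_of_cone {a : ι} (h : ∀ τ, a ∉ τ → E τ ≤ D (insert a τ)) (i : ℕ) :
    cycles E i ≤ bdries D i := by
  rintro f ⟨hf, hd⟩
  refine ⟨wedge K a f, wedge_mem_chains h hf, ?_⟩
  have := boundary_wedge_add (K := K) a f
  rwa [LinearMap.mem_ker.1 hd, map_zero, add_zero] at this

theorem homDim_eq_zero_of_le (hD : Antitone D) {i : ℕ} (h : cycles D i ≤ bdries D i) :
    homDim D i = 0 := by
  rw [homDim, le_antisymm h (bdries_le_cycles hD i), sub_self]

theorem homDim_eq_zero_of_cone (hD : Antitone D) {a : ι}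
    (h : ∀ τ, a ∉ τ → D τ ≤ D (insert a τ)) (i : ℕ) : homDim D i = 0 :=
  homDim_eq_zero_of_le hD (cycles_le_bdries_of_cone h i)

end Koszul

/-! ### Dimension counts and dimension shifting -/

section Homology

variable {ι : Type*} [LinearOrder ι] [Fintype ι] {K : Type*} [Field K]
variable {V W : Type*} [AddCommGroup V] [Module K V] [AddCommGroup W] [Module K W]

theorem finrank_map_add_finrank_inf_ker [FiniteDimensional K V] (T : V →ₗ[K] W)
    (P : Submodule K V) :
    Module.finrank K (P.map T) + Module.finrank K (P ⊓ LinearMap.ker T : Submodule K V) =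
      Module.finrank K P := by
  rw [← LinearMap.finrank_range_add_finrank_ker (T.domRestrict P), LinearMap.range_domRestrict,
    LinearMap.ker_domRestrict]
  congr 1
  rw [← Submodule.map_comap_subtype]
  exact (Submodule.equivMapOfInjective P.subtype P.injective_subtype _).finrank_eq.symm

variable [FiniteDimensional K V] [FiniteDimensional K W]

/-- Rank-nullity for the boundary eliminates the boundaries, so later counts only have to follow
cycles and chains through linear maps. -/
theorem homDim_eq (D : Finset ι → Submodule K V) (i : ℕ) :
    homDim D i = Module.finrank K (cycles D i) + Module.finrank K (cycles D (i + 1))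
      - Module.finrank K (chains D (i + 1)) := by
  have := finrank_map_add_finrank_inf_ker (boundary K) (chains D (i + 1))
  rw [homDim, bdries, cycles, cycles, ← this]
  push_cast
  ring

theorem map_compLeft_chains (φ : V →ₗ[K] W) (D : Finset ι → Submodule K V) (i : ℕ) :
    (chains D i).map (φ.compLeft (Finset ι)) = chains (fun τ => (D τ).map φ) i := by
  apply le_antisymm
  · rintro _ ⟨f, hf, rfl⟩ τ
    exact ⟨⟨f τ, (hf τ).1, rfl⟩, fun h => by simp [(hf τ).2 h]⟩
  · intro g hg
    choose f hf hfg using fun τ => (hg τ).1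
    -- The pointwise lifts of the zero values need not vanish, hence the cut-off to sets of the
    -- right size.
    refine ⟨fun τ => if τ.card = i then f τ else 0, fun τ => ?_, ?_⟩
    · by_cases h : τ.card = i
      · simp only [h, if_true]; exact ⟨hf τ, fun h2 => absurd rfl h2⟩
      · simp [h]
    · ext τ
      by_cases h : τ.card = i
      · simpa [h] using hfg τ
      · simp [h, (hg τ).2 h]

theorem chains_inf_ker (φ : V →ₗ[K] W) (D : Finset ι → Submodule K V) (i : ℕ) :
    chains D i ⊓ LinearMap.ker (φ.compLeft (Finset ι)) =
      chains (fun τ => D τ ⊓ LinearMap.ker φ) i := by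
  ext f
  constructor
  · rintro ⟨hf, h⟩ τ
    exact ⟨⟨(hf τ).1, congrFun (LinearMap.mem_ker.1 h) τ⟩, (hf τ).2⟩
  · intro hf
    exact ⟨fun τ => ⟨(hf τ).1.1, (hf τ).2⟩, LinearMap.mem_ker.2 (funext fun τ => (hf τ).1.2)⟩

/-- Dimension shifting: along a short exact sequence with acyclic middle term, the homology of the
kernel is that of the image one degree higher. -/
theorem homDim_ker_eq_homDim_map {D : Finset ι → Submodule K V} (hD : Antitone D)
    (φ : V →ₗ[K] W) {i : ℕ} (h1 : cycles D (i + 1) ≤ bdries D (i + 1))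
    (h0 : cycles (fun τ => D τ ⊓ LinearMap.ker φ) i ≤ bdries D i) :
    homDim (fun τ => D τ ⊓ LinearMap.ker φ) i = homDim (fun τ => (D τ).map φ) (i + 1) := by
  set S : Finset ι → Submodule K V := fun τ => D τ ⊓ LinearMap.ker φ with hS
  set N : Finset ι → Submodule K W := fun τ => (D τ).map φ with hN
  set Φ := φ.compLeft (Finset ι) with hΦ
  have hDc := le_antisymm h1 (bdries_le_cycles hD (i + 1))
  -- the chains whose boundary lies in the kernel
  set P : Submodule K (Finset ι → V) := chains D (i + 1) ⊓ (LinearMap.ker Φ).comap (boundary K)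
    with hP
  -- Lifting a cycle of the kernel only requires that it bounds in `D`, not that `D` is acyclic in
  -- degree `i`.
  have e1 : P.map (boundary K) = cycles S i := by
    apply le_antisymm
    · rintro _ ⟨f, ⟨hf, hf2⟩, rfl⟩
      refine ⟨?_, boundary_boundary f⟩
      rw [hS, ← chains_inf_ker]
      exact ⟨boundary_mem_chains hD hf, hf2⟩
    · intro g hg
      obtain ⟨f, hf, rfl⟩ := h0 hg
      refine ⟨f, ⟨hf, ?_⟩, rfl⟩
      have := hg.1
      rw [hS, ← chains_inf_ker] at this
      exact this.2
  have e2 : P ⊓ LinearMap.ker (boundary K) = cycles D (i + 1) := by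
    ext f
    constructor
    · rintro ⟨⟨hf, _⟩, h⟩; exact ⟨hf, h⟩
    · rintro ⟨hf, h⟩
      refine ⟨⟨hf, ?_⟩, h⟩
      change boundary K f ∈ LinearMap.ker Φ
      rw [LinearMap.mem_ker.1 h]; exact zero_mem _
  have e3 : P.map Φ = cycles N (i + 1) := by
    apply le_antisymm
    · rintro _ ⟨f, ⟨hf, hf2⟩, rfl⟩
      refine ⟨?_, ?_⟩
      · rw [hN, ← map_compLeft_chains]; exact ⟨f, hf, rfl⟩
      · rw [SetLike.mem_coe, LinearMap.mem_ker, boundary_compLeft]; exact hf2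
    · rintro g ⟨hg, hg2⟩
      rw [hN, ← map_compLeft_chains] at hg
      obtain ⟨f, hf, rfl⟩ := hg
      refine ⟨f, ⟨hf, ?_⟩, rfl⟩
      rw [SetLike.mem_coe, LinearMap.mem_ker, boundary_compLeft] at hg2
      exact hg2
  have e4 : P ⊓ LinearMap.ker Φ = chains S (i + 1) := by
    rw [hS, ← chains_inf_ker]
    ext f
    constructor
    · rintro ⟨⟨hf, _⟩, h⟩; exact ⟨hf, h⟩
    · rintro ⟨hf, h⟩
      refine ⟨⟨hf, ?_⟩, h⟩
      change boundary K f ∈ LinearMap.ker Φ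
      rw [LinearMap.mem_ker, ← boundary_compLeft]
      rw [LinearMap.mem_ker.1 h, map_zero]
  have e5 : (bdries D (i + 1)).map Φ = bdries N (i + 1) := by
    rw [bdries, bdries, hN, ← map_compLeft_chains, ← Submodule.map_comp, ← Submodule.map_comp]
    congr 1
    refine LinearMap.ext fun f => ?_
    exact (boundary_compLeft φ f).symm
  have e6 : bdries D (i + 1) ⊓ LinearMap.ker Φ = cycles S (i + 1) := by
    rw [← hDc, cycles, cycles, hS, ← chains_inf_ker, inf_right_comm]
  -- The dimension of `P` is counted once through the boundary and once through `Φ`; the count for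
  -- the boundaries of `D`, which are all its cycles, supplies the missing relation.
  have r1 := finrank_map_add_finrank_inf_ker (boundary K) P
  have r2 := finrank_map_add_finrank_inf_ker Φ P
  have r3 := finrank_map_add_finrank_inf_ker Φ (bdries D (i + 1))
  rw [e1, e2] at r1
  rw [e3, e4] at r2
  rw [e5, e6] at r3
  rw [homDim_eq S i, homDim]
  rw [hDc] at r1
  omega

/-- A surjection with small kernel preserves homology in degree `0`. -/
theorem homDim_zero_map {D : Finset ι → Submodule K V} (hD : Antitone D)
    (φ : V →ₗ[K] W) (h0 : cycles (fun τ => D τ ⊓ LinearMap.ker φ) 0 ≤ bdries D 0) :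
    homDim (fun τ => (D τ).map φ) 0 = homDim D 0 := by
  have r1 := finrank_map_add_finrank_inf_ker (φ.compLeft (Finset ι)) (chains D 0)
  have r2 := finrank_map_add_finrank_inf_ker (φ.compLeft (Finset ι)) (bdries D 0)
  -- Every 0-chain of the kernel bounds in `D`, so `φ` divides chains and boundaries by the same
  -- subspace.
  have e1 : bdries D 0 ⊓ LinearMap.ker (φ.compLeft (Finset ι)) =
      chains D 0 ⊓ LinearMap.ker (φ.compLeft (Finset ι)) := by
    apply le_antisymm
    · exact inf_le_inf_right _ ((bdries_le_cycles hD 0).trans inf_le_left)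
    · refine le_inf ?_ inf_le_right
      rw [chains_inf_ker, ← cycles_zero]
      exact h0
  have e2 : (bdries D 0).map (φ.compLeft (Finset ι)) = bdries (fun τ => (D τ).map φ) 0 := by
    rw [bdries, bdries, ← map_compLeft_chains, ← Submodule.map_comp, ← Submodule.map_comp]
    congr 1
    refine LinearMap.ext fun f => ?_
    exact (boundary_compLeft φ f).symm
  rw [e1, e2] at r2
  rw [map_compLeft_chains] at r1
  rw [homDim, homDim, cycles_zero, cycles_zero]
  omega

/-! ### Deletion and link of a vertex -/

/-- The deletion of the vertex `a`. -/
def deletion (a : ι) (D : Finset ι → Submodule K V) (τ : Finset ι) : Submodule K V :=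
  if a ∈ τ then ⊥ else D τ

/-- The link of the vertex `a`. -/
def link (a : ι) (D : Finset ι → Submodule K V) (τ : Finset ι) : Submodule K V :=
  if a ∈ τ then ⊥ else D (insert a τ)

/-- Up to sign, contraction with `a` reads off exactly the values on sets containing `a`. Its kernel
on chains is therefore the deletion and its image the link. -/
theorem contract_eq_zero_iff {a : ι} {f : Finset ι → V} :
    contract K a f = 0 ↔ ∀ τ, a ∈ τ → f τ = 0 := by
  constructor
  · intro h τ ha
    have h1 := congrFun h (τ.erase a)
    rw [contract_apply_of_notMem (Finset.notMem_erase a τ), Finset.insert_erase ha,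
      Pi.zero_apply] at h1
    have h2 := insertSign_mul_self (K := K) a (τ.erase a)
    rw [← one_smul K (f τ), ← h2, mul_smul, h1, smul_zero]
  · intro h
    ext τ
    by_cases ha : a ∈ τ
    · rw [contract_apply_of_mem ha]; rfl
    · rw [contract_apply_of_notMem ha, h _ (Finset.mem_insert_self a τ), smul_zero]; rfl

theorem chains_inf_ker_contract (a : ι) (D : Finset ι → Submodule K V) (i : ℕ) :
    chains D i ⊓ LinearMap.ker (contract K a) = chains (deletion a D) i := by
  ext f
  rw [Submodule.mem_inf, LinearMap.mem_ker, contract_eq_zero_iff]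
  constructor
  · rintro ⟨hf, h⟩ τ
    refine ⟨?_, (hf τ).2⟩
    unfold deletion
    split_ifs with ha
    · simpa using h τ ha
    · exact (hf τ).1
  · intro hf
    refine ⟨fun τ => ⟨?_, (hf τ).2⟩, fun τ ha => ?_⟩
    · have := (hf τ).1
      unfold deletion at this
      split_ifs at this with ha
      · rw [(Submodule.mem_bot K).1 this]; exact zero_mem _
      · exact this
    · have := (hf τ).1
      unfold deletion at this
      rwa [if_pos ha, Submodule.mem_bot] at this

theorem cycles_inf_ker_contract (a : ι) (D : Finset ι → Submodule K V) (i : ℕ) :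
    cycles D i ⊓ LinearMap.ker (contract K a) = cycles (deletion a D) i := by
  rw [cycles, cycles, inf_right_comm, chains_inf_ker_contract]

theorem contract_mem_chains_link {a : ι} {D : Finset ι → Submodule K V} {i : ℕ}
    {f : Finset ι → V} (hf : f ∈ chains D (i + 1)) : contract K a f ∈ chains (link a D) i := by
  intro τ
  by_cases ha : a ∈ τ
  · rw [contract_apply_of_mem ha]
    exact ⟨zero_mem _, fun _ => rfl⟩
  · rw [contract_apply_of_notMem ha, link, if_neg ha]
    refine ⟨Submodule.smul_mem _ _ (hf _).1, fun h => ?_⟩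
    rw [(hf _).2, smul_zero]
    rw [Finset.card_insert_of_notMem ha]
    omega

theorem contract_wedge_of_mem_link {a : ι} {D : Finset ι → Submodule K V} {i : ℕ}
    {f : Finset ι → V} (hf : f ∈ chains (link a D) i) : contract K a (wedge K a f) = f := by
  have h : contract K a f = 0 := by
    rw [contract_eq_zero_iff]
    intro τ ha
    have := (hf τ).1
    rwa [link, if_pos ha, Submodule.mem_bot] at this
  have h2 := contract_wedge_self_add (K := K) a f
  rwa [h, map_zero, add_zero] at h2

theorem wedge_mem_chains_of_mem_link {a : ι} {D : Finset ι → Submodule K V} {i : ℕ}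
    {f : Finset ι → V} (hf : f ∈ chains (link a D) i) : wedge K a f ∈ chains D (i + 1) :=
  wedge_mem_chains (fun τ ha => by rw [link, if_neg ha]) hf

theorem map_contract_chains (a : ι) (D : Finset ι → Submodule K V) (i : ℕ) :
    (chains D (i + 1)).map (contract K a) = chains (link a D) i := by
  apply le_antisymm
  · rintro _ ⟨f, hf, rfl⟩; exact contract_mem_chains_link hf
  · intro f hf
    exact ⟨wedge K a f, wedge_mem_chains_of_mem_link hf, contract_wedge_of_mem_link hf⟩

/-- The connecting map sends a cycle of the link to the same cycle in the deletion. The hypothesis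
makes it zero, so every cycle of the link lifts. -/
theorem map_contract_cycles {a : ι} {D : Finset ι → Submodule K V} {i : ℕ}
    (h : cycles (link a D) i ≤ bdries (deletion a D) i) :
    (cycles D (i + 1)).map (contract K a) = cycles (link a D) i := by
  apply le_antisymm
  · rintro _ ⟨f, ⟨hf, hd⟩, rfl⟩
    refine ⟨contract_mem_chains_link hf, ?_⟩
    have := boundary_contract_add (K := K) a f
    rwa [LinearMap.mem_ker.1 hd, map_zero, add_zero] at this
  · intro g hg
    obtain ⟨u, hu, hug⟩ := h hg
    rw [← chains_inf_ker_contract] at hu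
    -- The cone over `g` has boundary `g`, which is also the boundary of `u`; contraction with `a`
    -- recovers `g` and kills `u`.
    refine ⟨wedge K a g - u, ⟨sub_mem (wedge_mem_chains_of_mem_link hg.1) hu.1, ?_⟩, ?_⟩
    · have := boundary_wedge_add (K := K) a g
      rw [LinearMap.mem_ker.1 hg.2, map_zero, add_zero] at this
      rw [SetLike.mem_coe, LinearMap.mem_ker, map_sub, this, hug, sub_self]
    · rw [map_sub, contract_wedge_of_mem_link hg.1, LinearMap.mem_ker.1 hu.2, sub_zero]

/-- If the link of `a` is homologically trivial in the deletion, then the long exact sequence of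
the vertex `a` splits. -/
theorem homDim_succ_eq_deletion_add_link {a : ι} {D : Finset ι → Submodule K V}
    (h : ∀ i, cycles (link a D) i ≤ bdries (deletion a D) i) (i : ℕ) :
    homDim D (i + 1) = homDim (deletion a D) (i + 1) + homDim (link a D) i := by
  have r0 := finrank_map_add_finrank_inf_ker (contract K a) (cycles D (i + 1))
  have r1 := finrank_map_add_finrank_inf_ker (contract K a) (cycles D (i + 1 + 1))
  have r2 := finrank_map_add_finrank_inf_ker (contract K a) (chains D (i + 1 + 1))
  rw [map_contract_cycles (h _), cycles_inf_ker_contract] at r0 r1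
  rw [map_contract_chains, chains_inf_ker_contract] at r2
  rw [homDim_eq, homDim_eq, homDim_eq]
  omega

/-- The empty set does not contain `a`, so the 0-chains agree. Passing to the whole complex adds no
boundaries either: 0-chains of the link are cycles and already bound in the deletion. -/
theorem homDim_zero_eq_deletion {a : ι} {D : Finset ι → Submodule K V}
    (h : ∀ i, cycles (link a D) i ≤ bdries (deletion a D) i) :
    homDim D 0 = homDim (deletion a D) 0 := by
  have r1 := finrank_map_add_finrank_inf_ker (contract K a) (cycles D (0 + 1))
  have r2 := finrank_map_add_finrank_inf_ker (contract K a) (chains D (0 + 1))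
  rw [map_contract_cycles (h _), cycles_inf_ker_contract] at r1
  rw [map_contract_chains, chains_inf_ker_contract] at r2
  have e : chains (deletion a D) 0 = chains D 0 := by
    rw [← chains_inf_ker_contract, inf_eq_left]
    intro f hf
    rw [LinearMap.mem_ker, contract_eq_zero_iff]
    intro τ ha
    exact (hf τ).2 (Finset.card_ne_zero_of_mem ha)
  rw [homDim_eq, homDim_eq, cycles_zero, cycles_zero, e]
  rw [cycles_zero] at r1
  omega

/-! ### Discarding unused vertices -/

section Transport

variable {κ : Type*} [LinearOrder κ] [Fintype κ] (e : κ ↪o ι)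

/-- Extension by zero along an order embedding of the vertex sets. -/
noncomputable def extendChain (K : Type*) [Field K] [Module K V] (e : κ ↪o ι) :
    (Finset κ → V) →ₗ[K] (Finset ι → V) where
  toFun f := Function.extend (Finset.map e.toEmbedding) f 0
  map_add' f g := by
    rw [← Function.extend_add, add_zero]
  map_smul' r f := by
    rw [RingHom.id_apply, ← Function.extend_smul, smul_zero]

theorem extendChain_map (f : Finset κ → V) (σ : Finset κ) :
    extendChain K e f (σ.map e.toEmbedding) = f σ :=
  (Finset.map_injective e.toEmbedding).extend_apply f (0 : Finset ι → V) σ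

theorem extendChain_of_notMem (f : Finset κ → V) {τ : Finset ι}
    (h : ∀ σ : Finset κ, σ.map e.toEmbedding ≠ τ) : extendChain K e f τ = 0 := by
  exact Function.extend_apply' f (0 : Finset ι → V) τ (fun ⟨σ, hσ⟩ => h σ hσ)

theorem insertSign_map (c : κ) (σ : Finset κ) :
    insertSign K (e c) (σ.map e.toEmbedding) = insertSign K c σ := by
  simp [insertSign, Finset.prod_map]

theorem exists_map_eq_of_insert {c : ι} {τ : Finset ι} {σ : Finset κ}
    (h : σ.map e.toEmbedding = insert c τ) :
    (∃ c', e c' = c) ∧ ∃ σ' : Finset κ, σ'.map e.toEmbedding = τ := by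
  have h1 : ∀ x ∈ insert c τ, ∃ y, e y = x := by
    intro x hx
    rw [← h, Finset.mem_map] at hx
    obtain ⟨y, _, hy⟩ := hx
    exact ⟨y, hy⟩
  refine ⟨h1 c (Finset.mem_insert_self _ _), ?_⟩
  obtain ⟨u, -, hu⟩ := Finset.subset_map_iff.1
    (show τ ⊆ (Finset.univ : Finset κ).map e.toEmbedding from fun x hx => by
      obtain ⟨y, rfl⟩ := h1 x (Finset.mem_insert_of_mem hx)
      exact Finset.mem_map_of_mem _ (Finset.mem_univ y))
  exact ⟨u, hu.symm⟩

/-- A vertex outside the range leads to a set that is not an image, where the extension vanishes;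
for the others the signs agree because the embedding preserves the order. -/
theorem boundary_extendChain (f : Finset κ → V) :
    boundary K (extendChain K e f) = extendChain K e (boundary K f) := by
  ext τ
  simp only [boundary_apply, Finset.sum_apply]
  by_cases h : ∃ σ : Finset κ, σ.map e.toEmbedding = τ
  · obtain ⟨σ, rfl⟩ := h
    rw [extendChain_map, Finset.sum_apply]
    refine (Fintype.sum_of_injective e e.injective _ _ ?_ ?_).symm
    · intro c hc
      by_cases hcτ : c ∈ σ.map e.toEmbedding
      · rw [contract_apply_of_mem hcτ]
      · rw [contract_apply_of_notMem hcτ, extendChain_of_notMem, smul_zero]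
        intro σ' h'
        exact hc (exists_map_eq_of_insert e h').1
    · intro c
      by_cases hc : c ∈ σ
      · rw [contract_apply_of_mem hc, contract_apply_of_mem]
        exact Finset.mem_map_of_mem _ hc
      · have hc' : e c ∉ σ.map e.toEmbedding := fun h => hc (by simpa using h)
        rw [contract_apply_of_notMem hc, contract_apply_of_notMem hc', insertSign_map,
          ← extendChain_map (K := K) e f, Finset.map_insert]
        rfl
  · rw [extendChain_of_notMem e _ (fun σ hσ => h ⟨σ, hσ⟩)]
    refine Finset.sum_eq_zero fun c _ => ?_
    by_cases hcτ : c ∈ τ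
    · rw [contract_apply_of_mem hcτ]
    · rw [contract_apply_of_notMem hcτ, extendChain_of_notMem, smul_zero]
      intro σ' h'
      exact h (exists_map_eq_of_insert e h').2

/-- Homology does not change when vertices outside the support are discarded. -/
theorem homDim_eq_of_orderEmbedding {D : Finset ι → Submodule K V} {E : Finset κ → Submodule K V}
    (h1 : ∀ σ, D (σ.map e.toEmbedding) = E σ)
    (h2 : ∀ τ, (∀ σ : Finset κ, σ.map e.toEmbedding ≠ τ) → D τ = ⊥) (i : ℕ) :
    homDim D i = homDim E i := by
  have inj : Function.Injective (extendChain K e : (Finset κ → V) →ₗ[K] (Finset ι → V)) := by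
    intro f g h
    ext σ
    rw [← extendChain_map (K := K) e f, h, extendChain_map]
  have hc : ∀ i, chains D i = (chains E i).map (extendChain K e) := by
    intro i
    apply le_antisymm
    · intro f hf
      refine ⟨fun σ => f (σ.map e.toEmbedding), fun σ => ?_, ?_⟩
      · have := hf (σ.map e.toEmbedding)
        rwa [h1, Finset.card_map] at this
      · ext τ
        by_cases h : ∃ σ : Finset κ, σ.map e.toEmbedding = τ
        · obtain ⟨σ, rfl⟩ := h
          rw [extendChain_map]
        · have h' : ∀ σ : Finset κ, σ.map e.toEmbedding ≠ τ := fun σ hσ => h ⟨σ, hσ⟩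
          have := (hf τ).1
          rw [h2 τ h', Submodule.mem_bot] at this
          rw [extendChain_of_notMem e _ h', this]
    · rintro _ ⟨f, hf, rfl⟩ τ
      by_cases h : ∃ σ : Finset κ, σ.map e.toEmbedding = τ
      · obtain ⟨σ, rfl⟩ := h
        rw [extendChain_map, h1, Finset.card_map]
        exact hf σ
      · rw [extendChain_of_notMem e _ (fun σ hσ => h ⟨σ, hσ⟩)]
        exact ⟨zero_mem _, fun _ => rfl⟩
  have hb : ∀ i, bdries D i = (bdries E i).map (extendChain K e) := by
    intro i
    rw [bdries, bdries, hc, ← Submodule.map_comp, ← Submodule.map_comp]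
    congr 1
    refine LinearMap.ext fun f => ?_
    exact boundary_extendChain e f
  have hz : ∀ i, cycles D i = (cycles E i).map (extendChain K e) := by
    intro i
    rw [cycles, cycles, hc]
    apply le_antisymm
    · rintro _ ⟨⟨f, hf, rfl⟩, h⟩
      refine ⟨f, ⟨hf, ?_⟩, rfl⟩
      rw [SetLike.mem_coe, LinearMap.mem_ker, boundary_extendChain] at h
      exact inj (by rw [h, map_zero])
    · rintro _ ⟨f, ⟨hf, h⟩, rfl⟩
      refine ⟨⟨f, hf, rfl⟩, ?_⟩
      rw [SetLike.mem_coe, LinearMap.mem_ker, boundary_extendChain, LinearMap.mem_ker.1 h, map_zero]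
  rw [homDim, homDim, hb, hz, (Submodule.equivMapOfInjective _ inj (cycles E i)).finrank_eq,
    (Submodule.equivMapOfInjective _ inj (bdries E i)).finrank_eq]

end Transport

end Homology

/-! ### Graded families, free modules and minimal covers -/

section Graded

variable {ι : Type*} [LinearOrder ι] [Fintype ι] {K : Type*} [Field K]
variable {V W : Type*} [AddCommGroup V] [Module K V] [AddCommGroup W] [Module K W]

/-- The multidegree `μ` lowered by one at each element of `τ`. -/
def lower (μ : ι → ℕ) (τ : Finset ι) (c : ι) : ℕ := if c ∈ τ then μ c - 1 else μ c

theorem lower_empty (μ : ι → ℕ) : lower μ ∅ = μ := by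
  ext c; simp [lower]

theorem lower_le (μ : ι → ℕ) (τ : Finset ι) : lower μ τ ≤ μ := by
  intro c
  unfold lower
  split_ifs
  exacts [Nat.sub_le _ _, le_rfl]

theorem lower_antitone (μ : ι → ℕ) : Antitone (lower μ) := by
  intro τ σ h c
  have := @h c
  unfold lower
  split_ifs <;> first | exact Nat.sub_le _ _ | exact le_rfl | tauto

open Classical in
/-- The coefficients of the Koszul complex of the graded module `N` in multidegree `μ`. -/
noncomputable def atDeg (N : (ι → ℕ) → Submodule K V) (μ : ι → ℕ) (τ : Finset ι) :
    Submodule K V :=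
  -- The guard removes the sets for which truncated subtraction in `lower` would conceal a negative
  -- exponent.
  if ∀ c ∈ τ, 0 < μ c then N (lower μ τ) else ⊥

theorem atDeg_antitone {N : (ι → ℕ) → Submodule K V} (hN : Monotone N) (μ : ι → ℕ) :
    Antitone (atDeg N μ) := by
  intro τ σ h
  unfold atDeg
  by_cases h1 : ∀ c ∈ σ, 0 < μ c
  · rw [if_pos h1, if_pos fun c hc => h1 c (h hc)]
    exact hN (lower_antitone μ h)
  · rw [if_neg h1]; exact bot_le

theorem atDeg_map (N : (ι → ℕ) → Submodule K V) (φ : V →ₗ[K] W) (μ : ι → ℕ) :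
    atDeg (fun ν => (N ν).map φ) μ = fun τ => (atDeg N μ τ).map φ := by
  ext1 τ
  unfold atDeg
  split_ifs <;> simp

theorem atDeg_inf_ker (N : (ι → ℕ) → Submodule K V) (φ : V →ₗ[K] W) (μ : ι → ℕ) :
    atDeg (fun ν => N ν ⊓ LinearMap.ker φ) μ = fun τ => atDeg N μ τ ⊓ LinearMap.ker φ := by
  ext1 τ
  unfold atDeg
  split_ifs <;> simp

/-- The graded pieces of the free module with generators of multidegrees `deg b`. -/
def freeFamily (K : Type*) [Field K] {r : ℕ} (deg : Fin r → ι → ℕ) (ν : ι → ℕ) :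
    Submodule K (Fin r → K) where
  carrier := {w | ∀ b, w b ≠ 0 → deg b ≤ ν}
  add_mem' := by
    intro v w hv hw b hb
    by_cases h : v b = 0
    · exact hw b fun h2 => hb (by simp [h, h2])
    · exact hv b h
  zero_mem' := by intro b hb; exact absurd rfl hb
  smul_mem' := by
    intro r w hw b hb
    exact hw b fun h => hb (by simp [h])

variable {r : ℕ} {deg : Fin r → ι → ℕ}

theorem mem_freeFamily {ν : ι → ℕ} {w : Fin r → K} :
    w ∈ freeFamily K deg ν ↔ ∀ b, w b ≠ 0 → deg b ≤ ν := Iff.rfl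

theorem freeFamily_mono : Monotone (freeFamily K deg) :=
  fun _ _ h _ hw b hb => (hw b hb).trans h

theorem single_mem_freeFamily {b : Fin r} {ν : ι → ℕ} (h : deg b ≤ ν) (x : K) :
    Pi.single b x ∈ freeFamily K deg ν := by
  intro b' hb'
  by_cases h2 : b' = b
  · rwa [h2]
  · simp [h2] at hb'

/-- Coordinate `b` lives on the full simplex with vertices `c` such that `deg b c < μ c` when `deg b
≤ μ`, and nowhere otherwise. The Koszul complex of a free module is thus a sum of simplices. -/
theorem mem_atDeg_freeFamily {μ : ι → ℕ} {τ : Finset ι} {w : Fin r → K} :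
    w ∈ atDeg (freeFamily K deg) μ τ ↔
      ∀ b, w b ≠ 0 → deg b ≤ μ ∧ ∀ c ∈ τ, deg b c < μ c := by
  unfold atDeg
  by_cases h : ∀ c ∈ τ, 0 < μ c
  · rw [if_pos h, mem_freeFamily]
    refine forall_congr' fun b => forall_congr' fun _ => ?_
    constructor
    · intro h1
      refine ⟨h1.trans (lower_le μ τ), fun c hc => ?_⟩
      have h2 := h1 c
      have h3 := h c hc
      simp only [lower, if_pos hc] at h2
      omega
    · rintro ⟨h1, h2⟩ c
      have h3 := h1 c
      have h4 := h2 c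
      unfold lower
      split_ifs with hc
      · exact Nat.le_sub_one_of_lt (h4 hc)
      · exact h3
  · rw [if_neg h, Submodule.mem_bot]
    constructor
    · rintro rfl b hb; exact absurd rfl hb
    · intro h1
      ext b
      by_contra hb
      exact h fun c hc => Nat.zero_lt_of_lt ((h1 b hb).2 c hc)

/-- Argue coordinatewise. If `deg b` is strictly below `μ`, any `a` with `deg b a < μ a` is a cone
apex. If `deg b = μ`, only the empty set carries the coordinate, and there it vanishes by `h0`. -/
theorem mem_bdries_freeFamily {μ : ι → ℕ} {i : ℕ} {f : Finset ι → Fin r → K}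
    (hf : f ∈ cycles (atDeg (freeFamily K deg) μ) i) (h0 : ∀ b, deg b = μ → f ∅ b = 0) :
    f ∈ bdries (atDeg (freeFamily K deg) μ) i := by
  classical
  set P : Fin r → (Finset ι → Fin r → K) →ₗ[K] (Finset ι → K) :=
    fun b => (LinearMap.proj b : (Fin r → K) →ₗ[K] K).compLeft (Finset ι) with hP
  have hb : ∀ b, ∃ g : Finset ι → K, boundary K g = P b f ∧
      ∀ τ, (g τ ≠ 0 → (deg b ≤ μ ∧ ∀ c ∈ τ, deg b c < μ c)) ∧ (τ.card ≠ i + 1 → g τ = 0) := by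
    intro b
    by_cases hle : deg b ≤ μ ∧ deg b ≠ μ
    · obtain ⟨a, ha⟩ : ∃ a, deg b a < μ a := by
        by_contra! h
        exact hle.2 (le_antisymm hle.1 h)
      refine ⟨wedge K a (P b f), ?_, fun τ => ⟨fun h => ⟨hle.1, ?_⟩, fun h => ?_⟩⟩
      · have := boundary_wedge_add (K := K) a (P b f)
        rwa [boundary_compLeft, LinearMap.mem_ker.1 hf.2, map_zero, map_zero, add_zero] at this
      · by_cases hτ : a ∈ τ
        · rw [wedge_apply_of_mem hτ] at h
          have h1 := mem_atDeg_freeFamily.1 (hf.1 (τ.erase a)).1 b (right_ne_zero_of_mul h)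
          intro c hc
          by_cases hca : c = a
          · rwa [hca]
          · exact h1.2 c (Finset.mem_erase.2 ⟨hca, hc⟩)
        · exact absurd (wedge_apply_of_notMem hτ _) h
      · by_cases hτ : a ∈ τ
        · have h1 := Finset.card_erase_add_one hτ
          rw [wedge_apply_of_mem hτ]
          have h2 := (hf.1 (τ.erase a)).2 (by omega)
          simp [hP, h2]
        · exact wedge_apply_of_notMem hτ _
    · refine ⟨0, ?_, fun τ => ⟨fun h => absurd rfl h, fun _ => rfl⟩⟩
      rw [map_zero]
      ext τ
      by_contra h
      have h1 : f τ b ≠ 0 := fun h2 => h h2.symm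
      have h2 := mem_atDeg_freeFamily.1 (hf.1 τ).1 b h1
      have h3 : deg b = μ := by
        by_contra h4; exact hle ⟨h2.1, h4⟩
      obtain rfl | ⟨c, hc⟩ := τ.eq_empty_or_nonempty
      · exact h1 (h0 b h3)
      · exact absurd (h2.2 c hc) (by rw [h3]; exact lt_irrefl _)
  choose g hg1 hg2 using hb
  refine ⟨fun τ b => g b τ, fun τ => ⟨?_, fun h => ?_⟩, ?_⟩
  · exact mem_atDeg_freeFamily.2 fun b hb => (hg2 b τ).1 hb
  · ext b; exact (hg2 b τ).2 h
  · ext τ b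
    have h1 : P b (fun τ b => g b τ) = g b := rfl
    have h2 := congrFun (boundary_compLeft (K := K) (LinearMap.proj b : (Fin r → K) →ₗ[K] K)
      (fun τ b => g b τ)) τ
    have h3 := congrFun (hg1 b) τ
    exact h2.symm.trans h3

/-- Evaluation at the empty set on the coordinates of degree exactly `μ` is onto, and its kernel on
cycles is the space of boundaries. -/
theorem homDim_freeFamily_zero (deg : Fin r → ι → ℕ) (μ : ι → ℕ) :
    homDim (atDeg (freeFamily K deg) μ) 0 = Nat.card {b // deg b = μ} := by
  classical
  set D := atDeg (freeFamily K deg) μ with hD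
  let T : (Finset ι → Fin r → K) →ₗ[K] ({b // deg b = μ} → K) :=
    (LinearMap.funLeft K K Subtype.val).comp (LinearMap.proj ∅)
  have hT : ∀ f b, T f b = f ∅ b.1 := fun _ _ => rfl
  have e1 : cycles D 0 ⊓ LinearMap.ker T = bdries D 0 := by
    apply le_antisymm
    · rintro f ⟨hf, h⟩
      exact mem_bdries_freeFamily hf fun b hb => congrFun (LinearMap.mem_ker.1 h) ⟨b, hb⟩
    · intro f hf
      refine ⟨bdries_le_cycles (atDeg_antitone freeFamily_mono μ) 0 hf, ?_⟩
      obtain ⟨g, hg, rfl⟩ := hf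
      refine LinearMap.mem_ker.2 (funext fun b => ?_)
      rw [hT, boundary_apply, Finset.sum_apply, Finset.sum_apply]
      refine Finset.sum_eq_zero fun c _ => ?_
      rw [contract_apply_of_notMem (Finset.notMem_empty c)]
      by_contra h
      have h2 := (mem_atDeg_freeFamily.1 (hg (insert c ∅)).1 b.1 (right_ne_zero_of_mul h)).2 c
        (Finset.mem_insert_self c ∅)
      rw [b.2] at h2
      exact lt_irrefl _ h2
  have e2 : (cycles D 0).map T = ⊤ := by
    rw [eq_top_iff]
    intro w _
    refine ⟨fun τ b => if h : τ = ∅ ∧ deg b = μ then w ⟨b, h.2⟩ else 0, ?_, ?_⟩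
    · rw [cycles_zero]
      intro τ
      refine ⟨mem_atDeg_freeFamily.2 fun b hb => ?_, fun h => ?_⟩
      · rw [Ne, dite_eq_right_iff, not_forall] at hb
        obtain ⟨⟨rfl, hb⟩, _⟩ := hb
        exact ⟨hb.le, by simp⟩
      · ext b
        have : τ ≠ ∅ := fun h2 => h (by simp [h2])
        simp [this]
    · ext b
      rw [hT]
      simp [b.2]
  have := finrank_map_add_finrank_inf_ker T (cycles D 0)
  rw [e1, e2, finrank_top, Module.finrank_fintype_fun_eq_card] at this
  rw [homDim, Nat.card_eq_fintype_card]
  omega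

variable [FiniteDimensional K V]

/-- `φ` is a minimal cover of its image by the free module with generators of degrees `deg b`. -/
def IsMinimalCover (deg : Fin r → ι → ℕ) (φ : (Fin r → K) →ₗ[K] V) : Prop :=
  ∀ ν, ∀ w ∈ freeFamily K deg ν, φ w = 0 → ∀ b, deg b = ν → w b = 0

/-- Minimality kills the coordinates of degree `μ` at the empty set, which are the only obstruction
in `mem_bdries_freeFamily`. -/
theorem IsMinimalCover.cycles_le {φ : (Fin r → K) →ₗ[K] V} (h : IsMinimalCover deg φ)
    (μ : ι → ℕ) (i : ℕ) :
    cycles (fun τ => atDeg (freeFamily K deg) μ τ ⊓ LinearMap.ker φ) i ≤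
      bdries (atDeg (freeFamily K deg) μ) i := by
  intro f hf
  refine mem_bdries_freeFamily ⟨fun τ => ⟨((hf.1 τ).1).1, (hf.1 τ).2⟩, hf.2⟩ fun b hb => ?_
  have h1 := (hf.1 ∅).1
  simp only [atDeg, Finset.notMem_empty, IsEmpty.forall_iff, implies_true, if_true,
    lower_empty] at h1
  exact h μ _ h1.1 h1.2 b hb

/-- This is the shift from `Tor` of the image to `Tor` of the syzygies. The free module is acyclic
in positive degrees; minimality replaces acyclicity in degree zero. -/
theorem IsMinimalCover.homDim_ker {φ : (Fin r → K) →ₗ[K] V} (h : IsMinimalCover deg φ)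
    (μ : ι → ℕ) (i : ℕ) :
    homDim (atDeg (fun ν => freeFamily K deg ν ⊓ LinearMap.ker φ) μ) i =
      homDim (atDeg (fun ν => (freeFamily K deg ν).map φ) μ) (i + 1) := by
  rw [atDeg_inf_ker, atDeg_map]
  refine homDim_ker_eq_homDim_map (atDeg_antitone freeFamily_mono μ) φ (fun f hf => ?_)
    (h.cycles_le μ i)
  refine mem_bdries_freeFamily hf fun b _ => ?_
  rw [(hf.1 ∅).2 (by simp)]
  rfl

theorem IsMinimalCover.homDim_zero {φ : (Fin r → K) →ₗ[K] V} (h : IsMinimalCover deg φ)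
    (μ : ι → ℕ) :
    homDim (atDeg (fun ν => (freeFamily K deg ν).map φ) μ) 0 = Nat.card {b // deg b = μ} := by
  rw [atDeg_map, homDim_zero_map (atDeg_antitone freeFamily_mono μ) φ (h.cycles_le μ 0),
    homDim_freeFamily_zero]

end Graded

/-! ### From polynomial modules to scalar matrices -/

section Polynomial

variable {K : Type*} [Field K] {n : ℕ}

open MvPolynomial (monomial coeff)

variable {r r' r'' : ℕ} {deg : Fin r → Fin n →₀ ℕ} {deg' : Fin r' → Fin n →₀ ℕ}
  {deg'' : Fin r'' → Fin n →₀ ℕ}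

/-- The graded pieces of a free module with multidegrees given as finitely supported functions. -/
def freePiece (K : Type*) [Field K] (deg : Fin r → Fin n →₀ ℕ) (ν : Fin n →₀ ℕ) :
    Submodule K (Fin r → K) := freeFamily K (fun b => ⇑(deg b)) ν

theorem mem_freePiece {ν : Fin n →₀ ℕ} {w : Fin r → K} :
    w ∈ freePiece K deg ν ↔ ∀ b, w b ≠ 0 → deg b ≤ ν := Iff.rfl

/-- The homogeneous component of multidegree `ν`, with all variables set to `1`. -/
noncomputable def slice (deg : Fin r → Fin n →₀ ℕ) (ν : Fin n →₀ ℕ) :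
    (Fin r → MvPolynomial (Fin n) K) →ₗ[K] (Fin r → K) where
  toFun v b := if deg b ≤ ν then coeff (ν - deg b) (v b) else 0
  map_add' v w := by ext b; by_cases h : deg b ≤ ν <;> simp [h]
  map_smul' c v := by ext b; by_cases h : deg b ≤ ν <;> simp [h]

/-- The homogeneous element of multidegree `ν` with coefficients `w`. -/
noncomputable def homogenize (deg : Fin r → Fin n →₀ ℕ) (ν : Fin n →₀ ℕ) (w : Fin r → K) :
    Fin r → MvPolynomial (Fin n) K := fun b => monomial (ν - deg b) (w b)

theorem slice_apply_of_le {ν : Fin n →₀ ℕ} {b : Fin r} (h : deg b ≤ ν)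
    (v : Fin r → MvPolynomial (Fin n) K) :
    slice deg ν v b = coeff (ν - deg b) (v b) := if_pos h

theorem slice_apply_of_not_le {ν : Fin n →₀ ℕ} {b : Fin r} (h : ¬ deg b ≤ ν)
    (v : Fin r → MvPolynomial (Fin n) K) :
    slice deg ν v b = 0 := if_neg h

theorem slice_mem (ν : Fin n →₀ ℕ) (v : Fin r → MvPolynomial (Fin n) K) :
    slice deg ν v ∈ freePiece K deg ν := by
  rw [mem_freePiece]
  intro b hb
  by_contra h
  exact hb (slice_apply_of_not_le h v)

theorem slice_homogenize {ν : Fin n →₀ ℕ} {w : Fin r → K} (hw : w ∈ freePiece K deg ν) :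
    slice deg ν (homogenize deg ν w) = w := by
  ext b
  by_cases h : deg b ≤ ν
  · rw [slice_apply_of_le h, homogenize, MvPolynomial.coeff_monomial, if_pos rfl]
  · rw [slice_apply_of_not_le h]
    by_contra h2
    exact h (mem_freePiece.1 hw b (Ne.symm h2))

theorem slice_homogenize_of_ne {ν ν' : Fin n →₀ ℕ} (hν : ν ≠ ν') {w : Fin r → K}
    (hw : w ∈ freePiece K deg ν) : slice deg ν' (homogenize deg ν w) = 0 := by
  ext b
  by_cases h : deg b ≤ ν'
  · rw [slice_apply_of_le h, homogenize, MvPolynomial.coeff_monomial, Pi.zero_apply,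
      ite_eq_right_iff]
    intro h1
    by_contra h2
    have h3 := mem_freePiece.1 hw b h2
    exact hν (by rw [← tsub_add_cancel_of_le h3, h1, tsub_add_cancel_of_le h])
  · rw [slice_apply_of_not_le h]; rfl

theorem coeff_eq_slice (v : Fin r → MvPolynomial (Fin n) K) (b : Fin r) (m : Fin n →₀ ℕ) :
    coeff m (v b) = slice deg (m + deg b) v b := by
  rw [slice_apply_of_le le_add_self, add_tsub_cancel_right]

theorem ext_slice {v w : Fin r → MvPolynomial (Fin n) K}
    (h : ∀ ν, slice deg ν v = slice deg ν w) : v = w := by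
  ext b m
  rw [coeff_eq_slice (deg := deg), coeff_eq_slice (deg := deg) w, h]

theorem finite_slice_ne_zero (deg : Fin r → Fin n →₀ ℕ) (v : Fin r → MvPolynomial (Fin n) K) :
    {ν | slice deg ν v ≠ 0}.Finite := by
  classical
  refine (Finset.finite_toSet (Finset.univ.biUnion fun b : Fin r =>
    (v b).support.image (· + deg b))).subset ?_
  intro ν hν
  obtain ⟨b, hb⟩ := Function.ne_iff.1 hν
  have h := mem_freePiece.1 (slice_mem ν v) b hb
  rw [slice_apply_of_le h] at hb
  simp only [Finset.coe_biUnion, Set.mem_iUnion, Finset.coe_image, Set.mem_image]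
  exact ⟨b, Finset.mem_coe.2 (Finset.mem_univ b), ν - deg b,
    Finset.mem_coe.2 (MvPolynomial.mem_support_iff.2 hb), tsub_add_cancel_of_le h⟩

/-- The linear map `T` is homogeneous of multidegree `0`, with matrix of scalars `A`. -/
def IsHomogeneousMap (deg : Fin r → Fin n →₀ ℕ) (deg' : Fin r' → Fin n →₀ ℕ)
    (T : (Fin r → MvPolynomial (Fin n) K)
      →ₗ[MvPolynomial (Fin n) K] (Fin r' → MvPolynomial (Fin n) K))
    (A : (Fin r → K) →ₗ[K] (Fin r' → K)) : Prop :=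
  ∀ b b', T (Pi.single b 1) b' = monomial (deg b - deg' b') (A (Pi.single b 1) b') ∧
    -- Without this clause the truncated exponent `deg b - deg' b'` would not be the true difference
    -- of degrees.
    (A (Pi.single b 1) b' ≠ 0 → deg' b' ≤ deg b)

theorem linearMap_pi_apply {S : Type*} [CommSemiring S] (T : (Fin r → S) →ₗ[S] (Fin r' → S))
    (v : Fin r → S) (b' : Fin r') : T v b' = ∑ b, v b * T (Pi.single b 1) b' := by
  rw [LinearMap.pi_apply_eq_sum_univ T v, Finset.sum_apply]
  refine Finset.sum_congr rfl fun b _ => ?_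
  have h : (fun j => if b = j then (1 : S) else 0) = Pi.single b 1 := by
    funext j
    simp [Pi.single_apply, eq_comm]
  rw [Pi.smul_apply, smul_eq_mul, h]

theorem exists_isHomogeneousMap_scalar
    (T : (Fin r → MvPolynomial (Fin n) K)
      →ₗ[MvPolynomial (Fin n) K] (Fin r' → MvPolynomial (Fin n) K))
    (h : ∀ b b', ∀ m ∈ (T (Pi.single b 1) b').support, m + deg' b' = deg b) :
    ∃ A, IsHomogeneousMap deg deg' T A := by
  classical
  refine ⟨(Matrix.of fun b' b => if deg' b' ≤ deg b then
    coeff (deg b - deg' b') (T (Pi.single b 1) b') else 0).mulVecLin, fun b b' => ?_⟩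
  rw [Matrix.mulVecLin_apply, Matrix.mulVec_single_one, Matrix.col_apply, Matrix.of_apply]
  refine ⟨?_, fun h2 => by by_contra h3; exact h2 (if_neg h3)⟩
  ext m
  rw [MvPolynomial.coeff_monomial]
  by_cases hm : m ∈ (T (Pi.single b 1) b').support
  · have h1 := h b b' m hm
    have h2 : deg' b' ≤ deg b := by rw [← h1]; exact le_add_self
    have h3 : deg b - deg' b' = m := by rw [← h1, add_tsub_cancel_right]
    rw [if_pos h3, if_pos h2, h3]
  · rw [MvPolynomial.notMem_support_iff.1 hm]
    split_ifs with h1 h2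
    · rw [h1, MvPolynomial.notMem_support_iff.1 hm]
    · rfl
    · rfl

theorem exists_isHomogeneousMap_lift (A : (Fin r → K) →ₗ[K] (Fin r' → K))
    (h : ∀ b, A (Pi.single b 1) ∈ freePiece K deg' (deg b)) :
    ∃ T : (Fin r → MvPolynomial (Fin n) K)
      →ₗ[MvPolynomial (Fin n) K] (Fin r' → MvPolynomial (Fin n) K),
      IsHomogeneousMap deg deg' T A := by
  refine ⟨(Matrix.of fun b' b =>
    (monomial (deg b - deg' b') (A (Pi.single b 1) b') : MvPolynomial (Fin n) K)).mulVecLin,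
    fun b b' => ⟨?_, ?_⟩⟩
  · rw [Matrix.mulVecLin_apply, Matrix.mulVec_single_one, Matrix.col_apply, Matrix.of_apply]
  · exact mem_freePiece.1 (h b) b'

variable {T : (Fin r → MvPolynomial (Fin n) K)
    →ₗ[MvPolynomial (Fin n) K] (Fin r' → MvPolynomial (Fin n) K)}
  {A : (Fin r → K) →ₗ[K] (Fin r' → K)}
  {T' : (Fin r' → MvPolynomial (Fin n) K)
    →ₗ[MvPolynomial (Fin n) K] (Fin r'' → MvPolynomial (Fin n) K)}
  {A' : (Fin r' → K) →ₗ[K] (Fin r'' → K)}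

/-- Monomial entries only shift exponents, so the same scalar matrix acts in every multidegree.
Ranges, kernels and exactness can hence be tested slice by slice. -/
theorem IsHomogeneousMap.slice_map (h : IsHomogeneousMap deg deg' T A) (ν : Fin n →₀ ℕ)
    (v : Fin r → MvPolynomial (Fin n) K) : slice deg' ν (T v) = A (slice deg ν v) := by
  ext b'
  rw [linearMap_pi_apply A]
  by_cases hb' : deg' b' ≤ ν
  · rw [slice_apply_of_le hb', linearMap_pi_apply T, MvPolynomial.coeff_sum]
    refine Finset.sum_congr rfl fun b _ => ?_
    rw [(h b b').1, MvPolynomial.coeff_mul_monomial']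
    by_cases hA : A (Pi.single b 1) b' = 0
    · simp [hA]
    · have h1 := (h b b').2 hA
      by_cases hb : deg b ≤ ν
      · rw [slice_apply_of_le hb, if_pos (tsub_le_tsub_right hb _)]
        congr 2
        rw [tsub_tsub, add_tsub_cancel_of_le h1]
      · rw [slice_apply_of_not_le hb, zero_mul, if_neg]
        intro h2
        apply hb
        rw [← tsub_add_cancel_of_le h1, ← tsub_add_cancel_of_le hb']
        exact add_le_add_left h2 _
  · rw [slice_apply_of_not_le hb']
    refine (Finset.sum_eq_zero fun b _ => ?_).symm
    by_cases hA : A (Pi.single b 1) b' = 0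
    · rw [hA, mul_zero]
    · rw [slice_apply_of_not_le, zero_mul]
      exact fun h2 => hb' (((h b b').2 hA).trans h2)

theorem IsHomogeneousMap.mem_range_iff (h : IsHomogeneousMap deg deg' T A)
    (v : Fin r' → MvPolynomial (Fin n) K) :
    v ∈ LinearMap.range T ↔ ∀ ν, slice deg' ν v ∈ (freePiece K deg ν).map A := by
  classical
  constructor
  · rintro ⟨u, rfl⟩ ν
    exact ⟨slice deg ν u, slice_mem ν u, (h.slice_map ν u).symm⟩
  · intro hv
    choose u hu hu2 using hv
    -- Only finitely many slices are nonzero, so the homogenized preimages of these can be added up.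
    refine ⟨∑ ν ∈ (finite_slice_ne_zero deg' v).toFinset, homogenize deg ν (u ν), ?_⟩
    apply ext_slice (deg := deg')
    intro ν
    rw [h.slice_map, map_sum]
    by_cases hν : slice deg' ν v = 0
    · rw [Finset.sum_eq_zero, map_zero, hν]
      intro ν' hν'
      refine slice_homogenize_of_ne ?_ (hu ν')
      rintro rfl
      simp [hν] at hν'
    · rw [Finset.sum_eq_single ν, slice_homogenize (hu ν), hu2]
      · intro ν' _ h2
        exact slice_homogenize_of_ne h2 (hu ν')
      · simp [hν]

theorem IsHomogeneousMap.apply_eq_zero_iff (h : IsHomogeneousMap deg deg' T A)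
    (v : Fin r → MvPolynomial (Fin n) K) :
    T v = 0 ↔ ∀ ν, A (slice deg ν v) = 0 := by
  constructor
  · intro h2 ν
    rw [← h.slice_map, h2, map_zero]
  · intro h2
    apply ext_slice (deg := deg')
    intro ν
    rw [h.slice_map, h2, map_zero]

theorem IsHomogeneousMap.exact_iff (h : IsHomogeneousMap deg deg' T A)
    (h' : IsHomogeneousMap deg' deg'' T' A') :
    Function.Exact T T' ↔
      ∀ ν, freePiece K deg' ν ⊓ LinearMap.ker A' = (freePiece K deg ν).map A := by
  constructor
  · intro hex ν
    apply le_antisymm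
    · rintro w ⟨hw, hw2⟩
      have h1 : T' (homogenize deg' ν w) = 0 := by
        rw [h'.apply_eq_zero_iff]
        intro ν'
        by_cases hν : ν = ν'
        · rw [← hν, slice_homogenize hw, LinearMap.mem_ker.1 hw2]
        · rw [slice_homogenize_of_ne hν hw, map_zero]
      have h2 := (h.mem_range_iff _).1 ((hex _).1 h1) ν
      rwa [slice_homogenize hw] at h2
    · rintro _ ⟨u, hu, rfl⟩
      have h1 : T' (T (homogenize deg ν u)) = 0 := (hex _).2 ⟨_, rfl⟩
      have h2 := h.slice_map ν (homogenize deg ν u)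
      rw [slice_homogenize hu] at h2
      rw [← h2]
      refine ⟨slice_mem _ _, ?_⟩
      rw [SetLike.mem_coe, LinearMap.mem_ker]
      exact (h'.apply_eq_zero_iff _).1 h1 ν
  · intro h1 v
    rw [h'.apply_eq_zero_iff]
    change _ ↔ v ∈ LinearMap.range T
    rw [h.mem_range_iff]
    refine forall_congr' fun ν => ?_
    rw [← h1]
    exact ⟨fun h2 => ⟨slice_mem ν v, h2⟩, fun h2 => h2.2⟩

/-- Covers composed with maps having no unit entries are minimal. -/
theorem IsHomogeneousMap.isMinimalCover (h : IsHomogeneousMap deg deg' T A)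
    (hmin : ∀ b b', MvPolynomial.constantCoeff (T (Pi.single b 1) b') = 0)
    {V : Type*} [AddCommGroup V] [Module K V] {φ : (Fin r' → K) →ₗ[K] V}
    (hφ : ∀ ν, freePiece K deg' ν ⊓ LinearMap.ker φ = (freePiece K deg ν).map A) :
    IsMinimalCover (fun b => ⇑(deg' b)) φ := by
  intro ν w hw hw0 b' hb'
  have h1 : w ∈ freePiece K deg' (Finsupp.equivFunOnFinite.symm ν) ⊓ LinearMap.ker φ := by
    exact ⟨hw, hw0⟩
  rw [hφ] at h1
  obtain ⟨u, hu, rfl⟩ := h1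
  rw [linearMap_pi_apply A]
  refine Finset.sum_eq_zero fun b _ => ?_
  by_contra h2
  have h3 := mem_freePiece.1 hu b (left_ne_zero_of_mul h2)
  have h4 := right_ne_zero_of_mul h2
  have h5 := (h b b').2 h4
  have h6 : deg b = deg' b' := by
    refine le_antisymm (h3.trans ?_) h5
    rw [← Finsupp.coe_le_coe]
    exact hb'.ge
  have h7 := hmin b b'
  rw [(h b b').1, h6, tsub_self, MvPolynomial.constantCoeff_monomial, if_pos rfl] at h7
  exact h4 h7

/-! ### Monomial ideals and independence of the resolution -/

open Classical in
/-- The graded pieces of the monomial ideal whose monomials satisfy `U`. -/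
noncomputable def predFamily (K : Type*) [Field K] (U : (Fin n → ℕ) → Prop) (ν : Fin n → ℕ) :
    Submodule K (Fin 1 → K) := if U ν then ⊤ else ⊥

theorem predFamily_mono {U : (Fin n → ℕ) → Prop} (hU : ∀ ν ν', ν ≤ ν' → U ν → U ν') :
    Monotone (predFamily K U) := by
  intro ν ν' h
  unfold predFamily
  by_cases h1 : U ν
  · rw [if_pos (hU _ _ h h1)]; exact le_top
  · rw [if_neg h1]; exact bot_le

/-- `I` is the monomial ideal spanned by the monomials whose exponents satisfy `U`. -/
def IsMonomialIdeal (I : Ideal (MvPolynomial (Fin n) K)) (U : (Fin n → ℕ) → Prop) : Prop :=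
  ∀ f, f ∈ I ↔ ∀ m ∈ f.support, U ⇑m

theorem mem_predFamily {U : (Fin n → ℕ) → Prop} {ν : Fin n → ℕ} {w : Fin 1 → K} :
    w ∈ predFamily K U ν ↔ (w 0 ≠ 0 → U ν) := by
  unfold predFamily
  by_cases h1 : U ν
  · simp [h1]
  · rw [if_neg h1, Submodule.mem_bot]
    constructor
    · rintro rfl; simp
    · intro h
      ext b
      rw [Subsingleton.elim b 0]
      by_contra h2
      exact h1 (h h2)

theorem IsMonomialIdeal.mem_iff_slice {I : Ideal (MvPolynomial (Fin n) K)} {U : (Fin n → ℕ) → Prop}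
    (hI : IsMonomialIdeal I U) (v : Fin 1 → MvPolynomial (Fin n) K) :
    v 0 ∈ I ↔ ∀ ν : Fin n →₀ ℕ, slice (fun _ => 0) ν v ∈ predFamily K U ν := by
  rw [hI]
  refine forall_congr' fun ν => ?_
  rw [mem_predFamily, slice_apply_of_le zero_le, tsub_zero, MvPolynomial.mem_support_iff]

/-- The augmentation as a map to a free module of rank one. -/
noncomputable def augToPi
    (a : (Fin r → MvPolynomial (Fin n) K) →ₗ[MvPolynomial (Fin n) K] MvPolynomial (Fin n) K) :
    (Fin r → MvPolynomial (Fin n) K) →ₗ[MvPolynomial (Fin n) K]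
      (Fin 1 → MvPolynomial (Fin n) K) :=
  LinearMap.pi fun _ => a

theorem IsHomogeneousMap.range_eq_iff
    {a : (Fin r → MvPolynomial (Fin n) K) →ₗ[MvPolynomial (Fin n) K] MvPolynomial (Fin n) K}
    {A : (Fin r → K) →ₗ[K] (Fin 1 → K)}
    (h : IsHomogeneousMap deg (fun _ => 0) (augToPi a) A) {I : Ideal (MvPolynomial (Fin n) K)}
    {U : (Fin n → ℕ) → Prop} (hI : IsMonomialIdeal I U) :
    LinearMap.range a = I ↔ ∀ ν : Fin n →₀ ℕ, (freePiece K deg ν).map A = predFamily K U ν := by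
  have h1 : ∀ v : Fin 1 → MvPolynomial (Fin n) K, v 0 ∈ LinearMap.range a ↔
      ∀ ν, slice (fun _ => 0) ν v ∈ (freePiece K deg ν).map A := by
    intro v
    rw [← h.mem_range_iff]
    constructor
    · rintro ⟨u, hu⟩
      refine ⟨u, funext fun b => ?_⟩
      rw [Subsingleton.elim b 0]; exact hu
    · rintro ⟨u, rfl⟩
      exact ⟨u, rfl⟩
  constructor
  · intro h2 ν
    have h3 : ∀ w : Fin 1 → K, w ∈ freePiece K (fun _ => (0 : Fin n →₀ ℕ)) ν :=
      fun w b _ => (zero_le : 0 ≤ (ν : Fin n → ℕ))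
    ext w
    have h4 := h1 (homogenize (fun _ => 0) ν w)
    rw [h2, hI.mem_iff_slice] at h4
    have h5 : ∀ (N : (Fin n →₀ ℕ) → Submodule K (Fin 1 → K)),
        (∀ ν', slice (fun _ => 0) ν' (homogenize (fun _ => 0) ν w) ∈ N ν') ↔ w ∈ N ν := by
      intro N
      constructor
      · intro h6
        have := h6 ν
        rwa [slice_homogenize (h3 w)] at this
      · intro h6 ν'
        by_cases hν : ν = ν'
        · rw [← hν, slice_homogenize (h3 w)]; exact h6
        · rw [slice_homogenize_of_ne hν (h3 w)]; exact zero_mem _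
    rw [h5 fun ν => predFamily K U ν, h5] at h4
    exact h4.symm
  · intro h2
    ext f
    have h3 := h1 fun _ => f
    simp only [h2] at h3
    rw [h3, ← hI.mem_iff_slice]

theorem exact_augToPi_iff {a : (Fin r → MvPolynomial (Fin n) K) →ₗ[MvPolynomial (Fin n) K]
      MvPolynomial (Fin n) K}
    (T : (Fin r' → MvPolynomial (Fin n) K) →ₗ[MvPolynomial (Fin n) K]
      (Fin r → MvPolynomial (Fin n) K)) :
    Function.Exact T (augToPi a) ↔ Function.Exact T a := by
  refine forall_congr' fun v => ?_
  have : augToPi a v = 0 ↔ a v = 0 :=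
    ⟨fun h => congrFun h 0, fun h => funext fun _ => h⟩
  rw [this]

/-- The multigraded Betti numbers read off from any minimal free resolution of a monomial ideal
are the dimensions of the homology of its Koszul complexes. -/
theorem MinimalFreeResolution.card_deg_eq {I : Ideal (MvPolynomial (Fin n) K)}
    (Q : MinimalFreeResolution I)
    {U : (Fin n → ℕ) → Prop} (hI : IsMonomialIdeal I U) (a : ℕ) (μ : Fin n →₀ ℕ) :
    (Nat.card {b // Q.deg a b = μ} : ℤ) = homDim (atDeg (predFamily K U) μ) a := by
  obtain ⟨A₀, hA₀⟩ := exists_isHomogeneousMap_scalar (deg := Q.deg 0)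
    (deg' := fun _ : Fin 1 => 0) (augToPi Q.aug)
    (fun b _ m hm => by rw [add_zero]; exact Q.aug_homogeneous b m hm)
  choose A hA using fun a => exists_isHomogeneousMap_scalar (deg := Q.deg (a + 1))
    (deg' := Q.deg a) (Q.d a) (Q.d_homogeneous a)
  have r0 := (hA₀.range_eq_iff hI).1 Q.range_aug
  have e0 := ((hA 0).exact_iff hA₀).1 ((exact_augToPi_iff _).2 Q.exact_zero)
  have e1 := fun a => ((hA (a + 1)).exact_iff (hA a)).1 (Q.exact_succ a)
  have m0 := (hA 0).isMinimalCover (Q.minimal 0) e0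
  have m1 := fun a => (hA (a + 1)).isMinimalCover (Q.minimal (a + 1)) (e1 a)
  have conv : ∀ {V : Type _} [AddCommGroup V] [Module K V]
      {M N : (Fin n → ℕ) → Submodule K V}, (∀ ν : Fin n →₀ ℕ, M ν = N ν) → M = N := by
    intro V _ _ M N h
    ext1 ν
    exact h (Finsupp.equivFunOnFinite.symm ν)
  have r0' : (fun ν => (freeFamily K (fun b => ⇑(Q.deg 0 b)) ν).map A₀) = predFamily K U :=
    conv r0
  have e0' : (fun ν => freeFamily K (fun b => ⇑(Q.deg 0 b)) ν ⊓ LinearMap.ker A₀) =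
      fun ν => (freeFamily K (fun b => ⇑(Q.deg 1 b)) ν).map (A 0) := conv e0
  have e1' : ∀ a, (fun ν => freeFamily K (fun b => ⇑(Q.deg (a + 1) b)) ν ⊓ LinearMap.ker (A a)) =
      fun ν => (freeFamily K (fun b => ⇑(Q.deg (a + 2) b)) ν).map (A (a + 1)) :=
    fun a => conv (e1 a)
  -- The image of `A a` is the family of syzygies at stage `a`, so passing from the ideal to it
  -- shifts homology `a + 1` times.
  have key : ∀ a i, homDim (atDeg (fun ν =>
      (freeFamily K (fun b => ⇑(Q.deg (a + 1) b)) ν).map (A a)) μ) i =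
      homDim (atDeg (predFamily K U) μ) (i + a + 1) := by
    intro a
    induction a with
    | zero => intro i; rw [← e0', m0.homDim_ker, r0']
    | succ a ih =>
      intro i
      rw [← e1', (m1 a).homDim_ker, ih]
      congr 1
      omega
  have hcard : ∀ a, Nat.card {b // Q.deg a b = μ} = Nat.card {b // ⇑(Q.deg a b) = ⇑μ} := by
    intro a
    simp only [DFunLike.coe_fn_eq]
  rw [hcard]
  cases a with
  | zero => rw [← m0.homDim_zero, r0']
  | succ a => rw [← (m1 a).homDim_zero, key, zero_add]

end Polynomial

/-! ### Existence of minimal free resolutions -/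

section Existence

variable {K : Type*} [Field K] {n : ℕ} {V : Type*} [AddCommGroup V] [Module K V]
  [FiniteDimensional K V]

/-- The part of `N ν` generated in smaller multidegrees. -/
def decomposables (N : (Fin n → ℕ) → Submodule K V) (ν : Fin n → ℕ) : Submodule K V :=
  ⨆ ν' : {ν' // ν' < ν}, N ν'

theorem le_decomposables (N : (Fin n → ℕ) → Submodule K V) {ν ν' : Fin n → ℕ} (h : ν' < ν) :
    N ν' ≤ decomposables N ν :=
  le_iSup (fun ν' : {ν' // ν' < ν} => N ν') ⟨ν', h⟩

/-- Infinitely many generating degrees would, by Dickson's lemma, contain an increasing sequence.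
Along it the subspaces stabilize, since `V` is finite-dimensional, so some generating degree would
have everything coming from a strictly smaller one. -/
theorem finite_generating_degrees {N : (Fin n → ℕ) → Submodule K V} (hN : Monotone N) :
    {ν | ¬ N ν ≤ decomposables N ν}.Finite := by
  by_contra hinf
  have hinf : {ν | ¬ N ν ≤ decomposables N ν}.Infinite := hinf
  set u := hinf.natEmbedding with hu
  obtain ⟨g, hg⟩ := (wellQuasiOrdered_le (α := Fin n → ℕ)).exists_monotone_subseq
    fun m => (u m : Fin n → ℕ)
  have hmono : Monotone fun m => N (u (g m)) := fun a b h => hN (hg a b h)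
  obtain ⟨m, hm⟩ := monotone_stabilizes_iff_noetherian.2 (inferInstanceAs (IsNoetherian K V))
    ⟨_, hmono⟩
  have h1 : N (u (g m)) = N (u (g (m + 1))) := hm (m + 1) (Nat.le_succ m)
  have h2 : (u (g m) : Fin n → ℕ) < u (g (m + 1)) := by
    refine lt_of_le_of_ne (hg _ _ (Nat.le_succ m)) fun h => ?_
    have := g.injective (u.injective (Subtype.ext h))
    omega
  exact (u (g (m + 1))).2 (h1 ▸ le_decomposables N h2)

theorem exists_complement_decomposables (N : (Fin n → ℕ) → Submodule K V) (hN : Monotone N)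
    (ν : Fin n → ℕ) :
    ∃ C : Submodule K V, C ⊓ decomposables N ν = ⊥ ∧ C ⊔ decomposables N ν = N ν := by
  have hle : decomposables N ν ≤ N ν := iSup_le fun ν' => hN ν'.2.le
  obtain ⟨C, hC⟩ := ComplementedLattice.exists_isCompl
    (⟨decomposables N ν, hle⟩ : Set.Iic (N ν))
  refine ⟨C.1, ?_, ?_⟩
  · rw [inf_comm]; exact congrArg Subtype.val hC.inf_eq_bot
  · rw [sup_comm]; exact congrArg Subtype.val hC.sup_eq_top

/-- Every monotone family of subspaces has a minimal cover by a free module of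
finite rank. -/
theorem exists_isMinimalCover {N : (Fin n → ℕ) → Submodule K V} (hN : Monotone N) :
    ∃ (r : ℕ) (deg : Fin r → Fin n →₀ ℕ) (φ : (Fin r → K) →ₗ[K] V),
      (∀ ν, (freeFamily K (fun b => ⇑(deg b)) ν).map φ = N ν) ∧
      IsMinimalCover (fun b => ⇑(deg b)) φ := by
  classical
  choose C hC1 hC2 using exists_complement_decomposables N hN
  have hfin : {ν | C ν ≠ ⊥}.Finite := by
    refine (finite_generating_degrees hN).subset fun ν hν h => hν ?_
    rw [← hC1 ν, inf_of_le_left]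
    exact le_trans (le_sup_left.trans (hC2 ν).le) h
  have : Finite {ν | C ν ≠ ⊥} := hfin
  -- The generators are bases of complements to the decomposable part; only finitely many degrees
  -- contribute.
  let B := Σ ν : {ν | C ν ≠ ⊥}, Fin (Module.finrank K (C ν))
  have : Fintype B := Fintype.ofFinite B
  let e : Fin (Fintype.card B) ≃ B := (Fintype.equivFin B).symm
  let vec : B → V := fun p => Module.finBasis K (C p.1) p.2
  have hvec : ∀ p : B, vec p ∈ C p.1 := fun p => (Module.finBasis K (C p.1) p.2).2
  let deg : Fin (Fintype.card B) → Fin n → ℕ := fun b => (e b).1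
  let φ : (Fin (Fintype.card B) → K) →ₗ[K] V := Fintype.linearCombination K fun b => vec (e b)
  have hφ : ∀ w, φ w = ∑ b, w b • vec (e b) := fun w => Fintype.linearCombination_apply K _ w
  have hle : ∀ ν, (freeFamily K deg ν).map φ ≤ N ν := by
    rintro ν _ ⟨w, hw, rfl⟩
    rw [hφ]
    refine Submodule.sum_mem _ fun b _ => ?_
    by_cases hb : w b = 0
    · rw [hb, zero_smul]; exact zero_mem _
    · refine Submodule.smul_mem _ _ (hN (hw b hb) ?_)
      rw [← hC2]
      exact Submodule.mem_sup_left (hvec _)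
  refine ⟨Fintype.card B, fun b => Finsupp.equivFunOnFinite.symm (deg b), φ, ?_, ?_⟩
  · change ∀ ν, (freeFamily K deg ν).map φ = N ν
    intro ν
    refine le_antisymm (hle ν) ?_
    induction ν using WellFoundedLT.induction with
    | ind ν ih =>
      rw [← hC2 ν]
      refine sup_le ?_ (iSup_le fun ν' => (ih ν' ν'.2).trans
        (Submodule.map_mono (freeFamily_mono ν'.2.le)))
      by_cases hν : C ν = ⊥
      · rw [hν]; exact bot_le
      · intro x hx
        have h1 := (Module.finBasis K (C ν)).sum_repr ⟨x, hx⟩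
        have h2 : _ = x := congrArg Subtype.val h1
        rw [← h2, Submodule.coe_sum]
        refine Submodule.sum_mem _ fun k _ => ?_
        rw [Submodule.coe_smul]
        refine Submodule.smul_mem _ _ ?_
        refine ⟨Pi.single (e.symm ⟨⟨ν, hν⟩, k⟩) 1, single_mem_freeFamily ?_ 1, ?_⟩
        · simp only [deg, Equiv.apply_symm_apply]; exact le_rfl
        · rw [hφ, Finset.sum_eq_single (e.symm ⟨⟨ν, hν⟩, k⟩)]
          · rw [Pi.single_eq_same, one_smul, Equiv.apply_symm_apply]
          · intro b _ hb
            rw [Pi.single_eq_of_ne hb, zero_smul]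
          · simp
  · change IsMinimalCover deg φ
    intro ν w hw hw0 b hb
    rw [hφ, ← Finset.sum_filter_add_sum_filter_not _ fun b => deg b = ν] at hw0
    have h2 : ∑ b with ¬ deg b = ν, w b • vec (e b) ∈ decomposables N ν := by
      refine Submodule.sum_mem _ fun b' hb' => ?_
      by_cases h : w b' = 0
      · rw [h, zero_smul]; exact zero_mem _
      · refine Submodule.smul_mem _ _ (le_decomposables N
          (lt_of_le_of_ne (hw b' h) (Finset.mem_filter.1 hb').2) ?_)
        rw [← hC2]
        exact Submodule.mem_sup_left (hvec _)
    have h1 : ∑ b with deg b = ν, w b • vec (e b) ∈ C ν := by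
      refine Submodule.sum_mem _ fun b' hb' => Submodule.smul_mem _ _ ?_
      rw [← (Finset.mem_filter.1 hb').2]
      exact hvec _
    -- In a relation of degree `ν`, the generators of that degree sum to an element of `C ν` and the
    -- remaining ones to a decomposable element; these subspaces meet in zero.
    have h3 : ∑ b with deg b = ν, w b • vec (e b) = 0 := by
      have : ∑ b with deg b = ν, w b • vec (e b) ∈ C ν ⊓ decomposables N ν := by
        refine ⟨h1, ?_⟩
        rw [eq_neg_of_add_eq_zero_left hw0]
        exact neg_mem h2
      rwa [hC1, Submodule.mem_bot] at this
    obtain ⟨⟨⟨ν₀, hν₀⟩, k⟩, rfl⟩ := e.symm.surjective b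
    have hb' : ν₀ = ν := by simpa [deg] using hb
    subst hb'
    have h4 : ∑ k' : Fin (Module.finrank K (C ν₀)),
        w (e.symm ⟨⟨ν₀, hν₀⟩, k'⟩) • Module.finBasis K (C ν₀) k' = 0 := by
      apply Subtype.ext
      rw [Submodule.coe_sum, Submodule.coe_zero, ← h3]
      refine Finset.sum_bij (fun k' _ => e.symm ⟨⟨ν₀, hν₀⟩, k'⟩) ?_ ?_ ?_ ?_
      · intro k' _
        simp [deg]
      · intro k₁ _ k₂ _ h
        have h' := e.symm.injective h
        cases h'
        rfl
      · intro b' hb'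
        obtain ⟨⟨⟨ν₁, hν₁⟩, k₁⟩, rfl⟩ := e.symm.surjective b'
        have : ν₁ = ν₀ := by simpa [deg] using hb'
        subst this
        exact ⟨k₁, Finset.mem_univ _, rfl⟩
      · intro k' _
        rw [Submodule.coe_smul]
        simp [vec]
    exact Fintype.linearIndependent_iff.1 (Module.finBasis K (C ν₀)).linearIndependent _ h4 k

/-- A graded submodule of a graded free module, with all variables set to `1`. -/
structure FreeSubmodule (K : Type*) [Field K] (n : ℕ) where
  rank : ℕ
  deg : Fin rank → Fin n →₀ ℕ
  piece : (Fin n → ℕ) → Submodule K (Fin rank → K)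
  mono : Monotone piece
  le_free : ∀ ν, piece ν ≤ freeFamily K (fun b => ⇑(deg b)) ν

namespace FreeSubmodule

variable (S : FreeSubmodule K n)

/-- The number of minimal generators. -/
noncomputable def coverRank : ℕ := (exists_isMinimalCover S.mono).choose

/-- The degrees of the minimal generators. -/
noncomputable def coverDeg : Fin S.coverRank → Fin n →₀ ℕ :=
  (exists_isMinimalCover S.mono).choose_spec.choose

/-- The minimal cover. -/
noncomputable def cover : (Fin S.coverRank → K) →ₗ[K] (Fin S.rank → K) :=
  (exists_isMinimalCover S.mono).choose_spec.choose_spec.choose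

theorem map_cover (ν : Fin n → ℕ) :
    (freeFamily K (fun b => ⇑(S.coverDeg b)) ν).map S.cover = S.piece ν :=
  (exists_isMinimalCover S.mono).choose_spec.choose_spec.choose_spec.1 ν

theorem isMinimalCover_cover : IsMinimalCover (fun b => ⇑(S.coverDeg b)) S.cover :=
  (exists_isMinimalCover S.mono).choose_spec.choose_spec.choose_spec.2

theorem cover_single_mem (b : Fin S.coverRank) :
    S.cover (Pi.single b 1) ∈ S.piece (S.coverDeg b) := by
  rw [← S.map_cover]
  exact ⟨_, single_mem_freeFamily le_rfl 1, rfl⟩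

/-- The syzygies of the minimal generators. -/
noncomputable def syzygy : FreeSubmodule K n where
  rank := S.coverRank
  deg := S.coverDeg
  piece ν := freeFamily K (fun b => ⇑(S.coverDeg b)) ν ⊓ LinearMap.ker S.cover
  mono _ _ h := inf_le_inf_right _ (freeFamily_mono h)
  le_free _ := inf_le_left

/-- The iterated syzygies. -/
noncomputable def iterSyzygy : ℕ → FreeSubmodule K n
  | 0 => S
  | a + 1 => (iterSyzygy a).syzygy

end FreeSubmodule

/-- Minimal covers are iterated on syzygies, starting from the ideal inside the free module of rank
one, and the scalar maps are lifted to monomial matrices. Since finite length is not demanded, the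
syzygy theorem is not needed. -/
theorem nonempty_minimalFreeResolution {I : Ideal (MvPolynomial (Fin n) K)}
    {U : (Fin n → ℕ) → Prop} (hU : ∀ ν ν', ν ≤ ν' → U ν → U ν') (hI : IsMonomialIdeal I U) :
    Nonempty (MinimalFreeResolution I) := by
  let S : FreeSubmodule K n :=
    { rank := 1
      deg := fun _ => 0
      piece := predFamily K U
      mono := predFamily_mono hU
      le_free := fun ν _ _ _ _ => (zero_le : 0 ≤ ν) }
  have hlift : ∀ a, ∃ T : (Fin (S.iterSyzygy a).coverRank → MvPolynomial (Fin n) K)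
      →ₗ[MvPolynomial (Fin n) K] (Fin (S.iterSyzygy a).rank → MvPolynomial (Fin n) K),
      IsHomogeneousMap (S.iterSyzygy a).coverDeg (S.iterSyzygy a).deg T
        (S.iterSyzygy a).cover := fun a =>
    exists_isHomogeneousMap_lift _ fun b => (S.iterSyzygy a).le_free _
      ((S.iterSyzygy a).cover_single_mem b)
  choose T hT using hlift
  let T₀ : (Fin S.coverRank → MvPolynomial (Fin n) K) →ₗ[MvPolynomial (Fin n) K]
    (Fin 1 → MvPolynomial (Fin n) K) := T 0
  have hT₀ : IsHomogeneousMap S.coverDeg (fun _ => 0) T₀ S.cover := hT 0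
  let aug : (Fin S.coverRank → MvPolynomial (Fin n) K) →ₗ[MvPolynomial (Fin n) K]
    MvPolynomial (Fin n) K := (LinearMap.proj 0).comp T₀
  have haug : augToPi aug = T₀ := by
    ext1 b
    refine LinearMap.ext fun x => funext fun i => ?_
    rw [Subsingleton.elim i 0]
    rfl
  have hsupp : ∀ {r r' : ℕ} {deg : Fin r → Fin n →₀ ℕ} {deg' : Fin r' → Fin n →₀ ℕ}
      {T : (Fin r → MvPolynomial (Fin n) K) →ₗ[MvPolynomial (Fin n) K]
        (Fin r' → MvPolynomial (Fin n) K)} {A : (Fin r → K) →ₗ[K] (Fin r' → K)},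
      IsHomogeneousMap deg deg' T A → ∀ b b', ∀ m ∈ (T (Pi.single b 1) b').support,
        m + deg' b' = deg b := by
    intro r r' deg deg' T A h b b' m hm
    rw [(h b b').1] at hm
    have h1 := Finset.mem_singleton.1 (MvPolynomial.support_monomial_subset hm)
    have h2 : A (Pi.single b 1) b' ≠ 0 := by
      intro h0
      rw [h0, MvPolynomial.monomial_zero] at hm
      simp at hm
    rw [h1, tsub_add_cancel_of_le ((h b b').2 h2)]
  let d : ∀ a, (Fin (S.iterSyzygy (a + 1)).coverRank → MvPolynomial (Fin n) K)
      →ₗ[MvPolynomial (Fin n) K] (Fin (S.iterSyzygy a).coverRank → MvPolynomial (Fin n) K) :=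
    fun a => T (a + 1)
  let A : ∀ a, (Fin (S.iterSyzygy (a + 1)).coverRank → K) →ₗ[K]
      (Fin (S.iterSyzygy a).coverRank → K) := fun a => (S.iterSyzygy (a + 1)).cover
  have hd : ∀ a, IsHomogeneousMap (S.iterSyzygy (a + 1)).coverDeg (S.iterSyzygy a).coverDeg
    (d a) (A a) := fun a => hT (a + 1)
  have hexact₀ : ∀ ν, freePiece K S.coverDeg ν ⊓ LinearMap.ker S.cover =
      (freePiece K (S.iterSyzygy 1).coverDeg ν).map (A 0) :=
    fun ν => ((S.iterSyzygy 1).map_cover ν).symm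
  have hexact : ∀ a ν, freePiece K (S.iterSyzygy (a + 1)).coverDeg ν ⊓ LinearMap.ker (A a) =
      (freePiece K (S.iterSyzygy (a + 2)).coverDeg ν).map (A (a + 1)) :=
    fun a ν => ((S.iterSyzygy (a + 2)).map_cover ν).symm
  have hmem : ∀ a b, A a (Pi.single b 1) ∈
      freeFamily K (fun b => ⇑((S.iterSyzygy a).coverDeg b)) ((S.iterSyzygy (a + 1)).coverDeg b) ⊓
        LinearMap.ker (S.iterSyzygy a).cover := fun a b => (S.iterSyzygy (a + 1)).cover_single_mem b
  rw [← haug] at hT₀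
  refine ⟨
    { rank := fun a => (S.iterSyzygy a).coverRank
      deg := fun a => (S.iterSyzygy a).coverDeg
      aug := aug
      d := d
      range_aug := (hT₀.range_eq_iff hI).2 fun ν => S.map_cover ν
      exact_zero := (exact_augToPi_iff _).1 (((hd 0).exact_iff hT₀).2 hexact₀)
      exact_succ := fun a => ((hd (a + 1)).exact_iff (hd a)).2 (hexact a)
      aug_homogeneous := ?_
      d_homogeneous := fun a b b' m hm => hsupp (hd a) b b' m hm
      minimal := ?_ }⟩
  · intro b m hm
    have := hsupp hT₀ b 0 m hm
    rwa [add_zero] at this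
  · intro a b b'
    rw [(hd a b b').1, MvPolynomial.constantCoeff_monomial]
    -- A nonzero constant entry forces equal degrees, while the column is a syzygy in that degree,
    -- where minimality of the preceding cover makes the coordinate vanish.
    by_contra h
    rw [ite_eq_right_iff, not_forall] at h
    obtain ⟨h1, h2⟩ := h
    have h4 : (S.iterSyzygy a).coverDeg b' = (S.iterSyzygy (a + 1)).coverDeg b :=
      le_antisymm ((hd a b b').2 h2) (tsub_eq_zero_iff_le.1 h1)
    exact h2 ((S.iterSyzygy a).isMinimalCover_cover _ _ (hmem a b).1 (hmem a b).2 b'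
      (congrArg _ h4))

/-- The definition chooses a resolution: existence opens the `dif`, and `card_deg_eq` makes the
choice irrelevant. -/
theorem multigradedBetti_eq_homDim {I : Ideal (MvPolynomial (Fin n) K)}
    {U : (Fin n → ℕ) → Prop} (hU : ∀ ν ν', ν ≤ ν' → U ν → U ν') (hI : IsMonomialIdeal I U)
    (a : ℕ) (μ : Fin n →₀ ℕ) :
    (multigradedBetti I a μ : ℤ) = homDim (atDeg (predFamily K U) μ) a := by
  have h := nonempty_minimalFreeResolution hU hI
  rw [multigradedBetti, dif_pos h, ← h.some.card_deg_eq hI, Nat.card_eq_fintype_card]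

end Existence

/-! ### Homology of simplicial complexes -/

section Simplicial

variable {ι : Type*} [LinearOrder ι] [Fintype ι] {K : Type*} [Field K]

open Classical in
/-- The constant coefficient system on the simplicial complex with faces `p`. -/
noncomputable def simplicial (K : Type*) [Field K] (p : Finset ι → Prop) (τ : Finset ι) :
    Submodule K (Fin 1 → K) := if p τ then ⊤ else ⊥

variable {p q : Finset ι → Prop}

theorem simplicial_congr (h : ∀ τ, p τ ↔ q τ) : simplicial K p = simplicial K q := by
  have : p = q := funext fun τ => propext (h τ)
  rw [this]

theorem simplicial_le {τ σ : Finset ι} (h : p τ → q σ) :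
    simplicial K p τ ≤ simplicial K q σ := by
  unfold simplicial
  by_cases h1 : p τ
  · rw [if_pos (h h1)]; exact le_top
  · rw [if_neg h1]; exact bot_le

theorem simplicial_antitone (h : ∀ τ σ, τ ⊆ σ → p σ → p τ) : Antitone (simplicial K p) :=
  fun τ σ hτ => simplicial_le (h τ σ hτ)

theorem deletion_simplicial (a : ι) :
    deletion a (simplicial K p) = simplicial K fun τ => a ∉ τ ∧ p τ := by
  ext1 τ
  unfold deletion simplicial
  by_cases h : a ∈ τ
  · rw [if_pos h, if_neg fun h3 => h3.1 h]
  · rw [if_neg h]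
    by_cases h2 : p τ
    · rw [if_pos h2, if_pos ⟨h, h2⟩]
    · rw [if_neg h2, if_neg fun h3 => h2 h3.2]

theorem link_simplicial (a : ι) :
    link a (simplicial K p) = simplicial K fun τ => a ∉ τ ∧ p (insert a τ) := by
  ext1 τ
  unfold link simplicial
  by_cases h : a ∈ τ
  · rw [if_pos h, if_neg fun h3 => h3.1 h]
  · rw [if_neg h]
    by_cases h2 : p (insert a τ)
    · rw [if_pos h2, if_pos ⟨h, h2⟩]
    · rw [if_neg h2, if_neg fun h3 => h2 h3.2]

theorem atDeg_predFamily {n : ℕ} (U : (Fin n → ℕ) → Prop) (μ : Fin n → ℕ) :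
    atDeg (predFamily K U) μ =
      simplicial K fun τ => (∀ c ∈ τ, 0 < μ c) ∧ U (lower μ τ) := by
  ext1 τ
  unfold atDeg simplicial predFamily
  by_cases h : ∀ c ∈ τ, 0 < μ c
  · rw [if_pos h]
    by_cases h2 : U (lower μ τ)
    · rw [if_pos h2, if_pos ⟨h, h2⟩]
    · rw [if_neg h2, if_neg fun h3 => h2 h3.2]
  · rw [if_neg h, if_neg fun h2 => h h2.1]

theorem homDim_simplicial_eq_zero_of_cone (hp : ∀ τ σ, τ ⊆ σ → p σ → p τ) {a : ι}
    (h : ∀ τ, a ∉ τ → p τ → p (insert a τ)) (i : ℕ) : homDim (simplicial K p) i = 0 :=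
  homDim_eq_zero_of_cone (simplicial_antitone hp) (fun τ ha => simplicial_le (h τ ha)) i

theorem chains_simplicial_eq_bot {i : ℕ} (h : ∀ τ, τ.card = i → ¬ p τ) :
    chains (simplicial K p) i = ⊥ := by
  rw [eq_bot_iff]
  intro f hf
  rw [Submodule.mem_bot]
  funext τ
  by_cases hτ : τ.card = i
  · have h1 := (hf τ).1
    rwa [simplicial, if_neg (h τ hτ), Submodule.mem_bot] at h1
  · exact (hf τ).2 hτ

theorem finrank_chains_simplicial_zero (h : p ∅) :
    Module.finrank K (chains (simplicial K p) 0) = 1 := by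
  classical
  have hle : ∀ f ∈ chains (simplicial K p) 0, ∀ τ, τ ≠ ∅ → f τ = 0 := fun f hf τ hτ =>
    (hf τ).2 (by rwa [Ne, Finset.card_eq_zero])
  let e : chains (simplicial K p) 0 ≃ₗ[K] (Fin 1 → K) :=
    { toFun := fun f => f.1 ∅
      map_add' := fun _ _ => rfl
      map_smul' := fun _ _ => rfl
      invFun := fun v => ⟨Pi.single ∅ v, fun τ => by
        by_cases hτ : τ = ∅
        · subst hτ; simp [simplicial, h]
        · simp [hτ]⟩
      left_inv := fun f => by
        apply Subtype.ext
        funext τ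
        by_cases hτ : τ = ∅
        · subst hτ; simp
        · simp [hτ, hle f.1 f.2 τ hτ]
      right_inv := fun v => by simp }
  rw [e.finrank_eq]
  simp

theorem homDim_simplicial_eq_zero_of_not_empty (hp : ∀ τ σ, τ ⊆ σ → p σ → p τ) (h : ¬ p ∅)
    (i : ℕ) : homDim (simplicial K p) i = 0 := by
  have h1 : ∀ i, chains (simplicial K p) i = ⊥ := fun i =>
    chains_simplicial_eq_bot fun τ _ hτ => h (hp _ _ (Finset.empty_subset τ) hτ)
  rw [homDim_eq, cycles, cycles, h1, h1]
  simp

/-- The complex is `{∅}`. Its reduced homology in dimension `-1` sits in degree `0`, as degrees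
count vertices. -/
theorem homDim_simplicial_of_no_vertex (hp : ∀ τ σ, τ ⊆ σ → p σ → p τ) (h : p ∅)
    (h1 : ∀ c, ¬ p {c}) (i : ℕ) : homDim (simplicial K p) i = if i = 0 then 1 else 0 := by
  have h2 : ∀ i, chains (simplicial K p) (i + 1) = ⊥ := fun i =>
    chains_simplicial_eq_bot fun τ hτ hpτ => by
      obtain ⟨c, hc⟩ := Finset.card_pos.1 (by omega : 0 < τ.card)
      exact h1 c (hp _ _ (Finset.singleton_subset_iff.2 hc) hpτ)
  have h3 : ∀ i, cycles (simplicial K p) (i + 1) = ⊥ := fun i => by rw [cycles, h2, bot_inf_eq]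
  rw [homDim_eq, h2, h3]
  cases i with
  | zero => rw [cycles_zero, finrank_chains_simplicial_zero h]; simp
  | succ i => rw [h3]; simp

/-- Only the empty set has to be coned off, so one vertex suffices and the whole complex need not be
a cone. -/
theorem homDim_simplicial_zero (hp : ∀ τ σ, τ ⊆ σ → p σ → p τ) {c : ι} (hc : p {c}) :
    homDim (simplicial K p) 0 = 0 := by
  refine homDim_eq_zero_of_le (simplicial_antitone hp) ?_
  refine le_trans ?_ (cycles_le_bdries_of_cone (a := c)
    (E := simplicial K fun τ => τ = ∅) (fun τ _ => simplicial_le ?_) 0)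
  · rintro f ⟨hf, hd⟩
    refine ⟨fun τ => ⟨?_, (hf τ).2⟩, hd⟩
    by_cases hτ : τ = ∅
    · simp [simplicial, hτ]
    · rw [(hf τ).2 (by rwa [Ne, Finset.card_eq_zero])]; exact zero_mem _
  · rintro rfl; exact hc

/-! ### Skeleta joined with a pair -/

/-- The faces of the union of `(skeleton of A) * B` and `A * Y`, where the skeleton consists of the
sets with fewer than `r` elements. -/
def joinFace (A B : Finset ι) (Y : Finset ι → Prop) (r : ℕ) (τ : Finset ι) : Prop :=
  τ ⊆ A ∪ B ∧ ((τ ∩ A).card < r ∨ Y (τ ∩ B))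

variable {A B : Finset ι} {Y : Finset ι → Prop}

theorem joinFace_down (hY : ∀ τ σ, τ ⊆ σ → Y σ → Y τ) (r : ℕ) (τ σ : Finset ι) (h : τ ⊆ σ)
    (hσ : joinFace A B Y r σ) : joinFace A B Y r τ := by
  refine ⟨h.trans hσ.1, hσ.2.imp (fun h1 => ?_) fun h1 => ?_⟩
  · exact (Finset.card_le_card (Finset.inter_subset_inter_right h)).trans_lt h1
  · exact hY _ _ (Finset.inter_subset_inter_right h) h1

theorem joinFace_insert {a : ι} (ha : a ∈ A) (haB : a ∉ B) {r : ℕ} {τ : Finset ι}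
    (h : joinFace A B Y r τ) : joinFace A B Y (r + 1) (insert a τ) := by
  refine ⟨Finset.insert_subset (Finset.mem_union_left _ ha) h.1,
    h.2.imp (fun h1 => ?_) fun h1 => ?_⟩
  · rw [Finset.insert_inter_of_mem ha]
    exact (Finset.card_insert_le _ _).trans_lt (Nat.succ_lt_succ h1)
  · rwa [Finset.insert_inter_of_notMem haB]

open Classical in
/-- The homology of the pair formed by the full simplex on `B` and the subcomplex of faces `Y`, with the
degree raised by one. -/
noncomputable def pairDim (K : Type*) [Field K] (B : Finset ι) (Y : Finset ι → Prop) (t : ℕ) : ℤ :=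
  -- For nonempty `B` the simplex is acyclic and the pair is governed by `Y` alone. For empty `B`
  -- the simplex is `{∅}`, which is not acyclic and must be treated separately.
  if B = ∅ then (if t = 0 ∧ ¬ Y ∅ then 1 else 0)
  else if t = 0 then 0 else homDim (simplicial K fun τ => τ ⊆ B ∧ Y τ) (t - 1)

theorem homDim_joinFace_zero (hY : ∀ τ σ, τ ⊆ σ → Y σ → Y τ) {a : ι} (ha : a ∈ A) (haB : a ∉ B)
    (i : ℕ) : homDim (simplicial K (joinFace A B Y 0)) i = 0 := by
  refine homDim_simplicial_eq_zero_of_cone (joinFace_down hY 0) (a := a) (fun τ _ h => ?_) i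
  refine ⟨Finset.insert_subset (Finset.mem_union_left _ ha) h.1, Or.inr ?_⟩
  rw [Finset.insert_inter_of_notMem haB]
  exact h.2.resolve_left (Nat.not_lt_zero _)

/-- The complex is the simplex on `B` with a cone of apex `a` attached along the faces of `Y` in
`B`, so it computes the homology of the pair. Deleting `a` leaves the simplex, and the link of `a`
is `Y` on `B`. -/
theorem homDim_joinFace_singleton (hY : ∀ τ σ, τ ⊆ σ → Y σ → Y τ) {a : ι} (haB : a ∉ B)
    (i : ℕ) : homDim (simplicial K (joinFace {a} B Y 1)) i = pairDim K B Y i := by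
  unfold pairDim
  by_cases hB : B = ∅
  · subst hB
    rw [if_pos rfl]
    by_cases h0 : Y ∅
    · rw [if_neg fun h => h.2 h0]
      refine homDim_simplicial_eq_zero_of_cone (joinFace_down hY 1) (a := a) (fun τ _ h => ?_) i
      refine ⟨Finset.insert_subset (by simp) h.1, Or.inr ?_⟩
      rwa [Finset.inter_empty]
    · rw [homDim_simplicial_of_no_vertex (joinFace_down hY 1)]
      · simp [h0]
      · exact ⟨Finset.empty_subset _, Or.inl (by simp)⟩
      · rintro c ⟨h1, h2⟩
        have : c = a := by simpa using h1
        subst this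
        simp [h0] at h2
  · rw [if_neg hB]
    obtain ⟨b, hb⟩ := Finset.nonempty_iff_ne_empty.2 hB
    have hdel : deletion a (simplicial K (joinFace {a} B Y 1)) = simplicial K fun τ => τ ⊆ B := by
      rw [deletion_simplicial]
      refine simplicial_congr fun τ => ⟨?_, ?_⟩
      · rintro ⟨h1, h2, -⟩ c hc
        have := h2 hc
        rw [Finset.mem_union, Finset.mem_singleton] at this
        rcases this with rfl | h
        · exact absurd hc h1
        · exact h
      · intro h
        have h1 : a ∉ τ := fun h2 => haB (h h2)
        refine ⟨h1, h.trans Finset.subset_union_right, Or.inl ?_⟩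
        rw [Finset.inter_singleton_of_notMem h1]
        simp
    have hlink : link a (simplicial K (joinFace {a} B Y 1)) =
        simplicial K fun τ => τ ⊆ B ∧ Y τ := by
      rw [link_simplicial]
      refine simplicial_congr fun τ => ⟨?_, ?_⟩
      · rintro ⟨h1, h2, h3⟩
        have h4 : τ ⊆ B := by
          intro c hc
          have := h2 (Finset.mem_insert_of_mem hc)
          rw [Finset.mem_union, Finset.mem_singleton] at this
          rcases this with rfl | h
          · exact absurd hc h1
          · exact h
        refine ⟨h4, ?_⟩
        have h5 := h3.resolve_left (by simp)
        rwa [Finset.insert_inter_of_notMem haB, Finset.inter_eq_left.2 h4] at h5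
      · rintro ⟨h, hYτ⟩
        have h1 : a ∉ τ := fun h2 => haB (h h2)
        refine ⟨h1, Finset.insert_subset (by simp) (h.trans Finset.subset_union_right), Or.inr ?_⟩
        rwa [Finset.insert_inter_of_notMem haB, Finset.inter_eq_left.2 h]
    have hcone : ∀ i, cycles (link a (simplicial K (joinFace {a} B Y 1))) i ≤
        bdries (deletion a (simplicial K (joinFace {a} B Y 1))) i := by
      rw [hdel, hlink]
      exact cycles_le_bdries_of_cone (a := b) fun τ _ =>
        simplicial_le fun h => Finset.insert_subset hb h.1
    have hdel0 : ∀ i, homDim (simplicial K fun τ => τ ⊆ B) i = 0 :=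
      homDim_simplicial_eq_zero_of_cone (fun τ σ h1 h2 => h1.trans h2) (a := b)
        fun τ _ h => Finset.insert_subset hb h
    cases i with
    | zero => rw [homDim_zero_eq_deletion hcone, hdel, hdel0, if_pos rfl]
    | succ i =>
      rw [homDim_succ_eq_deletion_add_link hcone, hdel, hdel0, hlink, zero_add,
        if_neg (Nat.succ_ne_zero i), Nat.add_sub_cancel]

/-- Deleting `a` keeps the bound on the skeleton and taking the link lowers it by one. The vertex
sequence splits because coning with `a'` raises the number of elements in `A` by at most one, so the
link is contractible inside the deletion. -/
theorem homDim_joinFace_insert {a a' : ι} (ha' : a' ∈ A)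
    (haA : a ∉ A) (haB : a ∉ B) (haB' : a' ∉ B) (r : ℕ) :
    homDim (simplicial K (joinFace (insert a A) B Y (r + 1))) 0 =
      homDim (simplicial K (joinFace A B Y (r + 1))) 0 ∧
    ∀ i, homDim (simplicial K (joinFace (insert a A) B Y (r + 1))) (i + 1) =
      homDim (simplicial K (joinFace A B Y (r + 1))) (i + 1) +
        homDim (simplicial K (joinFace A B Y r)) i := by
  have hsub : ∀ τ : Finset ι, a ∉ τ → (τ ⊆ insert a A ∪ B ↔ τ ⊆ A ∪ B) := by
    intro τ h
    rw [Finset.insert_union, Finset.subset_insert_iff_of_notMem h]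
  have hdel : deletion a (simplicial K (joinFace (insert a A) B Y (r + 1))) =
      simplicial K (joinFace A B Y (r + 1)) := by
    rw [deletion_simplicial]
    refine simplicial_congr fun τ => ⟨?_, ?_⟩
    · rintro ⟨h1, h2, h3⟩
      rw [Finset.inter_insert_of_notMem h1] at h3
      exact ⟨(hsub τ h1).1 h2, h3⟩
    · rintro ⟨h2, h3⟩
      have h1 : a ∉ τ := fun h => by
        have := h2 h
        rw [Finset.mem_union] at this
        tauto
      refine ⟨h1, (hsub τ h1).2 h2, ?_⟩
      rwa [Finset.inter_insert_of_notMem h1]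
  have hlink : link a (simplicial K (joinFace (insert a A) B Y (r + 1))) =
      simplicial K (joinFace A B Y r) := by
    have hcard : ∀ τ : Finset ι, a ∉ τ →
        (insert a τ ∩ insert a A).card = (τ ∩ A).card + 1 := by
      intro τ h
      rw [← Finset.insert_inter_distrib, Finset.card_insert_of_notMem]
      exact fun h2 => h (Finset.mem_inter.1 h2).1
    rw [link_simplicial]
    refine simplicial_congr fun τ => ⟨?_, ?_⟩
    · rintro ⟨h1, h2, h3⟩
      rw [hcard τ h1, Finset.insert_inter_of_notMem haB, Nat.add_lt_add_iff_right] at h3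
      exact ⟨(hsub τ h1).1 ((Finset.subset_insert a τ).trans h2), h3⟩
    · rintro ⟨h2, h3⟩
      have h1 : a ∉ τ := fun h => by
        have := h2 h
        rw [Finset.mem_union] at this
        tauto
      refine ⟨h1, Finset.insert_subset (by simp) ((hsub τ h1).2 h2), ?_⟩
      rwa [hcard τ h1, Finset.insert_inter_of_notMem haB, Nat.add_lt_add_iff_right]
  have hcone : ∀ i, cycles (link a (simplicial K (joinFace (insert a A) B Y (r + 1)))) i ≤
      bdries (deletion a (simplicial K (joinFace (insert a A) B Y (r + 1)))) i := by
    rw [hdel, hlink]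
    exact cycles_le_bdries_of_cone (a := a') fun τ _ =>
      simplicial_le fun h => joinFace_insert ha' haB' h
  refine ⟨?_, fun i => ?_⟩
  · rw [homDim_zero_eq_deletion hcone, hdel]
  · rw [homDim_succ_eq_deletion_add_link hcone, hdel, hlink]

/-- The subsets of `A` with at most `r` elements have the homology of a wedge of `(A.card -
1).choose r` spheres, and joining with the pair only shifts degrees. The induction on `A` is
Pascal's rule via `homDim_joinFace_insert`. -/
theorem homDim_joinFace_succ (hY : ∀ τ σ, τ ⊆ σ → Y σ → Y τ) (hA : A.Nonempty)
    (hAB : Disjoint A B) (r i : ℕ) :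
    homDim (simplicial K (joinFace A B Y (r + 1))) i =
      ((A.card - 1).choose r : ℤ) * if r ≤ i then pairDim K B Y (i - r) else 0 := by
  induction hA using Finset.Nonempty.cons_induction generalizing r i with
  | singleton a =>
    have haB : a ∉ B := Finset.disjoint_singleton_left.1 hAB
    cases r with
    | zero => simp [homDim_joinFace_singleton hY haB]
    | succ r =>
      rw [homDim_simplicial_eq_zero_of_cone (joinFace_down hY _) (a := a)]
      · simp
      · intro τ _ h
        refine ⟨Finset.insert_subset (by simp) h.1, Or.inl ?_⟩
        exact (Finset.card_le_card Finset.inter_subset_right).trans_lt (by simp)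
  | cons a A ha hA ih =>
    rw [Finset.cons_eq_insert] at hAB ⊢
    obtain ⟨haB, hAB'⟩ := Finset.disjoint_insert_left.1 hAB
    obtain ⟨a', ha'⟩ := hA
    have haB' : a' ∉ B := Finset.disjoint_left.1 hAB' ha'
    obtain ⟨h0, h1⟩ := homDim_joinFace_insert (K := K) (Y := Y) ha' ha haB haB' r
    obtain ⟨s, hs⟩ : ∃ s, A.card = s + 1 :=
      Nat.exists_eq_succ_of_ne_zero (Finset.card_ne_zero_of_mem ha')
    have ih' := ih hAB'
    rw [Finset.card_insert_of_notMem ha, hs]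
    rw [hs] at ih'
    simp only [Nat.add_sub_cancel] at ih' ⊢
    cases i with
    | zero =>
      rw [h0, ih']
      cases r with
      | zero => simp
      | succ r => simp
    | succ i =>
      rw [h1, ih']
      cases r with
      | zero => simp [homDim_joinFace_zero hY ha' haB']
      | succ r =>
        rw [ih', Nat.choose_succ_succ, Nat.add_sub_add_right]
        simp only [Nat.add_le_add_iff_right]
        push_cast
        ring

end Simplicial

/-! ### Koszul complexes of reliability ideals -/

section Reliability

variable {K : Type*} [Field K] {n : ℕ}

/-- The system with thresholds `k j, …, k M` performs at level `j` or above in the state `ν`. -/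
def Reliable (k : ℕ → ℕ) (j M : ℕ) (ν : Fin n → ℕ) : Prop :=
  ∃ l ∈ Finset.Icc j M, k l ≤ (Finset.univ.filter fun c => l ≤ ν c).card

theorem Reliable.mono {k : ℕ → ℕ} {j M : ℕ} (ν ν' : Fin n → ℕ) (h : ν ≤ ν')
    (hν : Reliable k j M ν) : Reliable k j M ν' := by
  obtain ⟨l, hl, hc⟩ := hν
  exact ⟨l, hl, hc.trans (Finset.card_le_card
    (Finset.monotone_filter_right _ fun c _ hc => hc.trans (h c)))⟩

theorem isMonomialIdeal_reliabilityIdeal (k : ℕ → ℕ) (j M : ℕ) :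
    IsMonomialIdeal (reliabilityIdeal K n k j M) (Reliable k j M) := by
  classical
  set E : Set (Fin n →₀ ℕ) := {e | ∃ i ∈ Finset.Icc j M, ∃ σ : Finset (Fin n), σ.card = k i ∧
    e = ∑ c ∈ σ, Finsupp.single c i} with hE
  have hprod : ∀ (σ : Finset (Fin n)) (i : ℕ), (∏ c ∈ σ, MvPolynomial.X c ^ i :
      MvPolynomial (Fin n) K) = MvPolynomial.monomial (∑ c ∈ σ, Finsupp.single c i) 1 := by
    intro σ i
    rw [MvPolynomial.monomial_sum_one]
    exact Finset.prod_congr rfl fun c _ => MvPolynomial.X_pow_eq_monomial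
  have hspan : reliabilityIdeal K n k j M =
      Ideal.span ((fun s => MvPolynomial.monomial s (1 : K)) '' E) := by
    rw [reliabilityIdeal, Ideal.sum_eq_sup, Finset.sup_eq_iSup]
    simp only [simpleIdeal]
    simp_rw [← Ideal.span_iUnion]
    congr 1
    ext f
    simp only [Set.mem_iUnion, Set.mem_image, hE, Set.mem_ofPred_eq]
    constructor
    · rintro ⟨i, hi, σ, hσ, rfl⟩
      exact ⟨_, ⟨i, hi, σ, hσ, rfl⟩, (hprod σ i).symm⟩
    · rintro ⟨_, ⟨i, hi, σ, hσ, rfl⟩, rfl⟩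
      exact ⟨i, hi, σ, hσ, (hprod σ i).symm⟩
  intro f
  rw [hspan, MvPolynomial.mem_ideal_span_monomial_image]
  refine forall₂_congr fun m _ => ?_
  have happ : ∀ (σ : Finset (Fin n)) (i : ℕ) (c : Fin n),
      (∑ c ∈ σ, Finsupp.single c i) c = if c ∈ σ then i else 0 := by
    intro σ i c
    rw [Finsupp.finsetSum_apply]
    simp [Finsupp.single_apply]
  constructor
  · rintro ⟨_, ⟨i, hi, σ, hσ, rfl⟩, hle⟩
    refine ⟨i, hi, hσ ▸ Finset.card_le_card fun c hc => ?_⟩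
    have := hle c
    rw [happ, if_pos hc] at this
    simpa using this
  · rintro ⟨i, hi, hle⟩
    obtain ⟨σ, hσ, hcard⟩ := Finset.exists_subset_card_eq hle
    refine ⟨_, ⟨i, hi, σ, hcard, rfl⟩, fun c => ?_⟩
    rw [happ]
    split_ifs with hc
    · simpa using hσ hc
    · exact Nat.zero_le _

/-- The multigraded Betti numbers of the reliability ideal. -/
noncomputable def reliabilityBetti (K : Type*) [Field K] (k : ℕ → ℕ) (j M : ℕ) (ν : Fin n → ℕ)
    (a : ℕ) : ℤ := homDim (atDeg (predFamily K (Reliable k j M)) ν) a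

theorem multigradedBetti_reliabilityIdeal (k : ℕ → ℕ) (j M a : ℕ) (μ : Fin n →₀ ℕ) :
    (multigradedBetti (reliabilityIdeal K n k j M) a μ : ℤ) = reliabilityBetti K k j M μ a :=
  multigradedBetti_eq_homDim Reliable.mono (isMonomialIdeal_reliabilityIdeal k j M) a μ

/-- The faces of the Koszul complex of the reliability ideal in multidegree `ν`. -/
def koszulFace (k : ℕ → ℕ) (j M : ℕ) (ν : Fin n → ℕ) (τ : Finset (Fin n)) : Prop :=
  (∀ c ∈ τ, 0 < ν c) ∧ Reliable k j M (lower ν τ)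

variable {k : ℕ → ℕ} {j M : ℕ} {ν : Fin n → ℕ}

theorem reliabilityBetti_eq (a : ℕ) :
    reliabilityBetti K k j M ν a = homDim (simplicial K (koszulFace k j M ν)) a := by
  rw [reliabilityBetti, atDeg_predFamily]
  rfl

theorem koszulFace_down (τ σ : Finset (Fin n)) (h : τ ⊆ σ) (hσ : koszulFace k j M ν σ) :
    koszulFace k j M ν τ :=
  ⟨fun c hc => hσ.1 c (h hc), hσ.2.mono _ _ (lower_antitone ν h)⟩

theorem lower_insert (ν : Fin n → ℕ) (c : Fin n) (τ : Finset (Fin n)) :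
    lower ν (insert c τ) =
      if c ∈ τ then lower ν τ else Function.update (lower ν τ) c (ν c - 1) := by
  split_ifs with h
  · rw [Finset.insert_eq_of_mem h]
  · funext x
    by_cases hx : x = c
    · subst hx; simp [lower]
    · simp [lower, hx]

/-- Lowering an entry above `M` by one changes no test at a level up to `M`, so `c` is a cone apex.
-/
theorem reliabilityBetti_eq_zero_of_lt {c : Fin n} (hc : M < ν c) (a : ℕ) :
    reliabilityBetti K k j M ν a = 0 := by
  rw [reliabilityBetti_eq]
  refine homDim_simplicial_eq_zero_of_cone koszulFace_down (a := c) (fun τ hτ h => ⟨?_, ?_⟩) a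
  · intro x hx
    rcases Finset.mem_insert.1 hx with rfl | hx
    · omega
    · exact h.1 x hx
  · obtain ⟨l, hl, hcard⟩ := h.2
    refine ⟨l, hl, hcard.trans (Finset.card_le_card fun x hx => ?_)⟩
    rw [lower_insert, if_neg hτ]
    rw [Finset.mem_filter] at hx ⊢
    refine ⟨hx.1, ?_⟩
    by_cases hxc : x = c
    · subst hxc
      rw [Function.update_self]
      have := (Finset.mem_Icc.1 hl).2
      omega
    · rw [Function.update_of_ne hxc]
      exact hx.2

theorem reliable_pred_iff (hM : 1 ≤ M) (hkM : 1 ≤ k M) {ν : Fin n → ℕ} (hν : ∀ c, ν c < M) :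
    Reliable k j M ν ↔ Reliable k j (M - 1) ν := by
  constructor
  · rintro ⟨l, hl, hc⟩
    obtain ⟨h1, h2⟩ := Finset.mem_Icc.1 hl
    by_cases hlM : l = M
    · subst hlM
      have : (Finset.univ.filter fun c => l ≤ ν c) = ∅ :=
        Finset.filter_eq_empty_iff.2 fun c _ => not_le.2 (hν c)
      rw [this, Finset.card_empty] at hc
      omega
    · exact ⟨l, Finset.mem_Icc.2 ⟨h1, by omega⟩, hc⟩
  · rintro ⟨l, hl, hc⟩
    obtain ⟨h1, h2⟩ := Finset.mem_Icc.1 hl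
    exact ⟨l, Finset.mem_Icc.2 ⟨h1, by omega⟩, hc⟩

theorem reliabilityBetti_pred (hM : 1 ≤ M) (hkM : 1 ≤ k M) (hν : ∀ c, ν c < M) (a : ℕ) :
    reliabilityBetti K k j M ν a = reliabilityBetti K k j (M - 1) ν a := by
  rw [reliabilityBetti_eq, reliabilityBetti_eq]
  congr 1
  refine simplicial_congr fun τ => and_congr_right fun _ => ?_
  exact reliable_pred_iff hM hkM fun c => (lower_le ν τ c).trans_lt (hν c)

/-- The multigraded Betti numbers of the quotient of the polynomial ring by the reliability
ideal. -/
noncomputable def quotientBetti (K : Type*) [Field K] (k : ℕ → ℕ) (j M : ℕ) (ν : Fin n → ℕ)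
    (t : ℕ) : ℤ :=
  open Classical in
  if ν = 0 then (if t = 0 ∧ ¬ Reliable k j M ν then 1 else 0)
  else if t = 0 then 0 else reliabilityBetti K k j M ν (t - 1)

/-- A component of level `M` still passes every lower test after being lowered. So `τ ∩ A` matters
only at level `M`, where at least `k M` components must remain, and `τ ∩ B` only below. When fewer
than `k M` components have level `M`, the truncated bound is `0` and the skeleton part is absent. -/
theorem koszulFace_iff_joinFace (hM : 1 ≤ M) (hjM : j ≤ M) (hkM : 1 ≤ k M) (hν : ∀ c, ν c ≤ M)
    (τ : Finset (Fin n)) :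
    koszulFace k j M ν τ ↔
      joinFace (Finset.univ.filter fun c => ν c = M)
        (Finset.univ.filter fun c => 0 < ν c ∧ ν c < M)
        (fun σ => ∃ l ∈ Finset.Icc j (M - 1), k l ≤ (Finset.univ.filter fun c => ν c = M).card +
          (Finset.univ.filter fun c => ν c < M ∧ l ≤ lower ν σ c).card)
        ((Finset.univ.filter fun c => ν c = M).card + 1 - k M) τ := by
  set A := Finset.univ.filter fun c => ν c = M with hA
  set B := Finset.univ.filter fun c => 0 < ν c ∧ ν c < M with hB
  have hAB : τ ⊆ A ∪ B ↔ ∀ c ∈ τ, 0 < ν c := by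
    refine forall₂_congr fun c _ => ?_
    have := hν c
    simp only [hA, hB, Finset.mem_union, Finset.mem_filter, Finset.mem_univ, true_and]
    omega
  unfold koszulFace joinFace
  rw [hAB]
  refine and_congr_right fun hτ => ?_
  have htop : (Finset.univ.filter fun c => M ≤ lower ν τ c).card + (τ ∩ A).card = A.card := by
    rw [← Finset.card_sdiff_add_card_inter A τ, Finset.inter_comm τ A]
    congr 2
    ext c
    have := hν c
    simp only [hA, Finset.mem_sdiff, Finset.mem_filter, Finset.mem_univ, true_and]
    unfold lower
    split_ifs with h
    · simp only [h, not_true, and_false, iff_false]; omega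
    · simp only [h, not_false_iff, and_true]; omega
  have hlow : ∀ l ≤ M - 1, (Finset.univ.filter fun c => l ≤ lower ν τ c).card =
      A.card + (Finset.univ.filter fun c => ν c < M ∧ l ≤ lower ν (τ ∩ B) c).card := by
    intro l hl
    rw [← Finset.card_union_of_disjoint]
    · congr 1
      ext c
      have h1 := hν c
      have h2 := hτ c
      simp only [hA, hB, Finset.mem_union, Finset.mem_filter, Finset.mem_univ, true_and]
      unfold lower
      simp only [Finset.mem_inter, Finset.mem_filter, Finset.mem_univ, true_and]
      by_cases hc : c ∈ τ
      · have h3 := h2 hc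
        simp only [hc, true_and, if_true, h3]
        by_cases h4 : ν c < M
        · simp only [h4, if_true, true_and]; omega
        · simp only [h4, if_false, false_and]; omega
      · simp only [hc, false_and, if_false]; omega
    · rw [Finset.disjoint_left]
      intro c h1 h2
      simp only [hA, Finset.mem_filter, Finset.mem_univ, true_and] at h1 h2
      omega
  constructor
  · rintro ⟨l, hl, hc⟩
    obtain ⟨h1, h2⟩ := Finset.mem_Icc.1 hl
    by_cases hlM : l = M
    · subst hlM
      left; omega
    · right
      refine ⟨l, Finset.mem_Icc.2 ⟨h1, by omega⟩, ?_⟩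
      rwa [hlow l (by omega)] at hc
  · rintro (h | ⟨l, hl, hc⟩)
    · exact ⟨M, Finset.mem_Icc.2 ⟨hjM, le_rfl⟩, by omega⟩
    · obtain ⟨h1, h2⟩ := Finset.mem_Icc.1 hl
      refine ⟨l, Finset.mem_Icc.2 ⟨h1, by omega⟩, ?_⟩
      rwa [hlow l h2]

/-- The multigraded Betti numbers in the multidegrees having an entry equal to the top level. -/
theorem reliabilityBetti_of_top (hM : 1 ≤ M) (hjM : j ≤ M) (hkM : 1 ≤ k M) (hν : ∀ c, ν c ≤ M)
    {m : ℕ} (e : Fin m ↪o Fin n) (he : ∀ c, c ∈ Set.range e ↔ ν c < M) (hm : m < n) (a : ℕ) :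
    reliabilityBetti K k j M ν a =
      if k M ≤ n - m ∧ n - m - k M ≤ a then
        ((n - m - 1).choose (k M - 1) : ℤ) *
          quotientBetti K (fun l => k l - (n - m)) j (M - 1) (ν ∘ e) (a - (n - m - k M))
      else 0 := by
  classical
  set A := Finset.univ.filter fun c => ν c = M with hA
  set B := Finset.univ.filter fun c => 0 < ν c ∧ ν c < M with hB
  set Y : Finset (Fin n) → Prop := fun σ => ∃ l ∈ Finset.Icc j (M - 1), k l ≤ A.card +
    (Finset.univ.filter fun c => ν c < M ∧ l ≤ lower ν σ c).card with hY
  have hYdown : ∀ τ σ, τ ⊆ σ → Y σ → Y τ := by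
    rintro τ σ h ⟨l, hl, hc⟩
    refine ⟨l, hl, hc.trans (Nat.add_le_add_left (Finset.card_le_card ?_) _)⟩
    exact Finset.monotone_filter_right _ fun c _ hc => ⟨hc.1, hc.2.trans (lower_antitone ν h c)⟩
  have hAB : Disjoint A B := by
    rw [Finset.disjoint_left]
    intro c h1 h2
    simp only [hA, hB, Finset.mem_filter, Finset.mem_univ, true_and] at h1 h2
    omega
  have hcardA : A.card = n - m := by
    have h1 : Aᶜ = Finset.univ.map e.toEmbedding := by
      ext c
      have h2 := hν c
      have h3 := he c
      simp only [hA, Finset.mem_compl, Finset.mem_filter, Finset.mem_univ, true_and,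
        Finset.mem_map, RelEmbedding.coe_toEmbedding]
      rw [Set.mem_range] at h3
      rw [h3]
      omega
    have h2 := congrArg Finset.card h1
    rw [Finset.card_compl, Finset.card_map, Finset.card_univ, Fintype.card_fin,
      Fintype.card_fin] at h2
    have h3 : A.card ≤ n := by simpa using A.card_le_univ
    omega
  have hAne : A.Nonempty := Finset.card_pos.1 (by omega)
  have hface : ∀ σ : Finset (Fin m),
      (σ.map e.toEmbedding ⊆ B ∧ Y (σ.map e.toEmbedding)) ↔
        koszulFace (fun l => k l - (n - m)) j (M - 1) (ν ∘ e) σ := by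
    intro σ
    refine and_congr ?_ (exists_congr fun l => and_congr_right fun _ => ?_)
    · simp only [Finset.subset_iff, Finset.mem_map, hB, Finset.mem_filter, Finset.mem_univ,
        true_and, RelEmbedding.coe_toEmbedding]
      constructor
      · intro h c hc
        exact (h ⟨c, hc, rfl⟩).1
      · rintro h _ ⟨c, hc, rfl⟩
        exact ⟨h c hc, (he _).1 ⟨c, rfl⟩⟩
    · have : (Finset.univ.filter fun c => ν c < M ∧ l ≤ lower ν (σ.map e.toEmbedding) c) =
          (Finset.univ.filter fun c => l ≤ lower (ν ∘ e) σ c).map e.toEmbedding := by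
        ext c
        simp only [Finset.mem_map, Finset.mem_filter, Finset.mem_univ, true_and,
          RelEmbedding.coe_toEmbedding]
        unfold lower
        simp only [Function.comp_apply]
        constructor
        · rintro ⟨h1, h2⟩
          obtain ⟨c, rfl⟩ := (he c).2 h1
          refine ⟨c, ?_, rfl⟩
          simpa using h2
        · rintro ⟨c, h1, rfl⟩
          refine ⟨(he _).1 ⟨c, rfl⟩, ?_⟩
          simpa using h1
      rw [this, Finset.card_map, hcardA]
      -- Truncated subtraction realizes the convention that a negative threshold reads as `0`.
      exact (tsub_le_iff_left).symm
  have hpair : ∀ t, pairDim K B Y t =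
      quotientBetti K (fun l => k l - (n - m)) j (M - 1) (ν ∘ e) t := by
    intro t
    have hB0 : B = ∅ ↔ ν ∘ e = 0 := by
      constructor
      · intro h
        funext c
        by_contra h0
        have : e c ∈ B := by
          rw [hB, Finset.mem_filter]
          exact ⟨Finset.mem_univ _, Nat.pos_of_ne_zero h0, (he _).1 ⟨c, rfl⟩⟩
        rw [h] at this
        simp at this
      · intro h
        rw [Finset.eq_empty_iff_forall_notMem]
        intro c hc
        rw [hB, Finset.mem_filter] at hc
        obtain ⟨c, rfl⟩ := (he c).2 hc.2.2
        have := congrFun h c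
        simp only [Function.comp_apply, Pi.zero_apply] at this
        omega
    have hY0 : Y ∅ ↔ Reliable (fun l => k l - (n - m)) j (M - 1) (ν ∘ e) := by
      have := hface ∅
      rw [Finset.map_empty, koszulFace, lower_empty] at this
      simpa using this
    unfold pairDim quotientBetti
    by_cases h0 : ν ∘ e = 0
    · rw [if_pos (hB0.2 h0), if_pos h0, hY0]
    · rw [if_neg (hB0.not.2 h0), if_neg h0]
      congr 1
      rw [reliabilityBetti_eq]
      refine homDim_eq_of_orderEmbedding e (fun σ => ?_) (fun τ hτ => ?_) _
      · unfold simplicial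
        by_cases hσ : σ.map e.toEmbedding ⊆ B ∧ Y (σ.map e.toEmbedding)
        · rw [if_pos hσ, if_pos ((hface σ).1 hσ)]
        · rw [if_neg hσ, if_neg fun h => hσ ((hface σ).2 h)]
      · unfold simplicial
        refine if_neg fun h => ?_
        obtain ⟨u, -, hu⟩ := Finset.subset_map_iff.1
          (show τ ⊆ (Finset.univ : Finset (Fin m)).map e.toEmbedding from fun x hx => by
            have := h.1 hx
            rw [hB, Finset.mem_filter] at this
            obtain ⟨y, rfl⟩ := (he x).2 this.2.2
            exact Finset.mem_map_of_mem _ (Finset.mem_univ y))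
        exact hτ u hu.symm
  rw [reliabilityBetti_eq, simplicial_congr (koszulFace_iff_joinFace hM hjM hkM hν)]
  change homDim (simplicial K (joinFace A B Y (A.card + 1 - k M))) a = _
  by_cases h : k M ≤ n - m
  · have h1 : A.card + 1 - k M = (n - m - k M) + 1 := by omega
    rw [h1, homDim_joinFace_succ hYdown hAne hAB, hcardA, hpair]
    have h2 : (n - m - 1).choose (n - m - k M) = (n - m - 1).choose (k M - 1) :=
      Nat.choose_symm_of_eq_add (by omega)
    rw [h2]
    by_cases h3 : n - m - k M ≤ a
    · rw [if_pos h3, if_pos ⟨h, h3⟩]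
    · rw [if_neg h3, if_neg fun h4 => h3 h4.2, mul_zero]
  -- With too few top components the complex is a cone over any vertex of `A`.
  · have h1 : A.card + 1 - k M = 0 := by omega
    obtain ⟨x, hx⟩ := hAne
    rw [h1, homDim_joinFace_zero hYdown hx (Finset.disjoint_left.1 hAB hx),
      if_neg fun h4 => h h4.1]

end Reliability

/-! ### Summation over multidegrees -/

section Weighted

variable {K : Type*} [Field K] {n : ℕ} {k : ℕ → ℕ} {j M : ℕ}

/-- The probability `∏_c p_{≥ ν_c}` of the monomial `x^ν`. -/
noncomputable def monomialProb (P : Measure ℕ) (ν : Fin n → ℕ) : ℝ := ∏ c, levelProb P (ν c)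

/-- The multidegrees with all entries smaller than `N`. -/
def degreeBox (n N : ℕ) : Finset (Fin n → ℕ) := Fintype.piFinset fun _ => Finset.range N

theorem mem_degreeBox {N : ℕ} {ν : Fin n → ℕ} : ν ∈ degreeBox n N ↔ ∀ c, ν c < N := by
  simp [degreeBox]

/-- Entries above `M` contribute nothing, so the `finsum` has finite support and does not take its
default value. -/
theorem weightedBetti_reliabilityIdeal (P : Measure ℕ) (k : ℕ → ℕ) (j M a : ℕ) :
    weightedBetti P (reliabilityIdeal K n k j M) a =
      ∑ ν ∈ degreeBox n (M + 1), (reliabilityBetti K k j M ν a : ℝ) * monomialProb P ν := by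
  have h : ∀ μ : Fin n →₀ ℕ, (multigradedBetti (reliabilityIdeal K n k j M) a μ : ℝ) *
      ∏ c, levelProb P (μ c) = (fun ν : Fin n → ℕ =>
        (reliabilityBetti K k j M ν a : ℝ) * monomialProb P ν) (Finsupp.equivFunOnFinite μ) := by
    intro μ
    have := multigradedBetti_reliabilityIdeal (K := K) k j M a μ
    have h2 : (multigradedBetti (reliabilityIdeal K n k j M) a μ : ℝ) =
        (reliabilityBetti K k j M μ a : ℝ) := by exact_mod_cast this
    rw [h2]
    rfl
  rw [weightedBetti, finsum_congr h, finsum_comp_equiv (f := fun ν : Fin n → ℕ =>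
        (reliabilityBetti K k j M ν a : ℝ) * monomialProb P ν)]
  refine finsum_eq_sum_of_support_subset _ fun ν hν => ?_
  rw [Finset.mem_coe, mem_degreeBox]
  intro c
  by_contra hc
  apply hν
  simp only
  rw [reliabilityBetti_eq_zero_of_lt (c := c) (by omega), Int.cast_zero, zero_mul]

/-- The weighted Betti numbers of the quotient ring. -/
noncomputable def weightedQuotientBetti (K : Type*) [Field K] (P : Measure ℕ) (n : ℕ) (k : ℕ → ℕ)
    (j M t : ℕ) : ℝ :=
  ∑ ν ∈ degreeBox n (M + 1), (quotientBetti K k j M ν t : ℝ) * monomialProb P ν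

/-- Degrees equal to `M` exactly on `A` are the degrees below `M` on the complement. The components
of `A` split off the power of `levelProb P M`, and `reliabilityBetti_of_top` evaluates the rest. -/
theorem sum_top_eq (hM : 1 ≤ M) (hjM : j ≤ M) (hkM : 1 ≤ k M) (P : Measure ℕ) (a : ℕ)
    {A : Finset (Fin n)} (hA : A.Nonempty) :
    ∑ ν ∈ degreeBox n (M + 1) with (Finset.univ.filter fun c => ν c = M) = A,
        (reliabilityBetti K k j M ν a : ℝ) * monomialProb P ν =
      levelProb P M ^ A.card * if k M ≤ A.card ∧ A.card - k M ≤ a then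
        ((A.card - 1).choose (k M - 1) : ℝ) *
          weightedQuotientBetti K P (n - A.card) (fun l => k l - A.card) j (M - 1)
            (a - (A.card - k M)) else 0 := by
  classical
  have hAn : A.card ≤ n := by simpa using A.card_le_univ
  have hpos : 0 < A.card := hA.card_pos
  have hcard : Aᶜ.card = n - A.card := by rw [Finset.card_compl, Fintype.card_fin]
  set m := n - A.card with hm
  have hnm : n - m = A.card := by omega
  set e : Fin m ↪o Fin n := Aᶜ.orderEmbOfFin hcard with he
  have hrange : ∀ c, c ∈ Set.range e ↔ c ∉ A := by
    intro c
    rw [he, Finset.range_orderEmbOfFin]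
    simp
  have hmap : Finset.univ.map e.toEmbedding = Aᶜ := by
    ext c
    rw [Finset.mem_compl, ← hrange]
    simp
  have hbij : ∑ ν ∈ degreeBox n (M + 1) with (Finset.univ.filter fun c => ν c = M) = A,
        (reliabilityBetti K k j M ν a : ℝ) * monomialProb P ν =
      ∑ ν ∈ degreeBox m (M - 1 + 1), levelProb P M ^ A.card * ((if k M ≤ A.card ∧ A.card - k M ≤ a
        then ((A.card - 1).choose (k M - 1) : ℝ) *
          (quotientBetti K (fun l => k l - A.card) j (M - 1) ν (a - (A.card - k M)) : ℝ) else 0) *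
            monomialProb P ν) := by
    refine Finset.sum_bij' (fun ν _ => ν ∘ e) (fun ν _ => Function.extend e ν fun _ => M)
      ?_ ?_ ?_ ?_ ?_
    · intro ν hν
      rw [Finset.mem_filter, mem_degreeBox] at hν
      rw [mem_degreeBox]
      intro c
      have h1 := hν.1 (e c)
      have h2 : e c ∉ A := (hrange _).1 ⟨c, rfl⟩
      rw [← hν.2, Finset.mem_filter, not_and] at h2
      have h3 := h2 (Finset.mem_univ _)
      simp only [Function.comp_apply]
      omega
    · intro ν hν
      rw [mem_degreeBox] at hν
      rw [Finset.mem_filter, mem_degreeBox]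
      have h1 : ∀ c, c ∈ A → Function.extend e ν (fun _ => M) c = M := by
        intro c hc
        rw [Function.extend_apply']
        intro h
        exact (hrange c).1 h hc
      have h2 : ∀ c, c ∉ A → Function.extend e ν (fun _ => M) c < M := by
        intro c hc
        obtain ⟨c, rfl⟩ := (hrange c).2 hc
        rw [e.injective.extend_apply]
        have := hν c
        omega
      refine ⟨fun c => ?_, ?_⟩
      · by_cases hc : c ∈ A
        · rw [h1 c hc]; omega
        · have := h2 c hc; omega
      · ext c
        rw [Finset.mem_filter]
        by_cases hc : c ∈ A
        · simp [hc, h1 c hc]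
        · have := h2 c hc
          simp only [Finset.mem_univ, true_and, hc, iff_false]
          omega
    · intro ν hν
      rw [Finset.mem_filter] at hν
      funext c
      by_cases hc : c ∈ A
      · rw [Function.extend_apply' _ _ _ fun h => (hrange c).1 h hc]
        rw [← hν.2, Finset.mem_filter] at hc
        exact hc.2.symm
      · obtain ⟨c, rfl⟩ := (hrange c).2 hc
        rw [e.injective.extend_apply]
        rfl
    · intro ν _
      funext c
      rw [Function.comp_apply, e.injective.extend_apply]
    · intro ν hν
      rw [Finset.mem_filter, mem_degreeBox] at hν
      have h1 : ∀ c, c ∈ A ↔ ν c = M := by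
        intro c
        rw [← hν.2]
        simp
      have h2 : ∀ c, ν c ≤ M := fun c => Nat.lt_succ_iff.1 (hν.1 c)
      have h3 : ∀ c, c ∈ Set.range e ↔ ν c < M := by
        intro c
        rw [hrange, h1]
        have := h2 c
        omega
      rw [reliabilityBetti_of_top hM hjM hkM h2 e h3 (by omega), hnm]
      have h4 : monomialProb P ν = levelProb P M ^ A.card * monomialProb P (ν ∘ e) := by
        rw [monomialProb, ← Finset.prod_mul_prod_compl A, ← hmap, Finset.prod_map]
        congr 1
        rw [Finset.prod_congr rfl fun c hc => by rw [(h1 c).1 hc], Finset.prod_const]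
      rw [h4]
      push_cast
      split_ifs
      · ring
      · simp
  rw [hbij, ← Finset.mul_sum, weightedQuotientBetti]
  congr 1
  split_ifs
  · rw [Finset.mul_sum]
    refine Finset.sum_congr rfl fun ν _ => ?_
    ring
  · simp

/-- Group the degrees by the set `A` of top components. The empty set gives the system without level
`M`, sets with fewer than `k M` elements give zero, and the contribution of any other set depends
only on its size. -/
theorem weightedBetti_recursion (hM : 1 ≤ M) (hjM : j ≤ M) (hkM : 1 ≤ k M) (P : Measure ℕ)
    (a : ℕ) :
    weightedBetti P (reliabilityIdeal K n k j M) a =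
      weightedBetti P (reliabilityIdeal K n k j (M - 1)) a +
      ∑ i ∈ Finset.range (n + 1 - k M), (n.choose (k M + i) : ℝ) * levelProb P M ^ (k M + i) *
        if i ≤ a then ((i + k M - 1).choose (k M - 1) : ℝ) *
          weightedQuotientBetti K P (n - k M - i) (fun l => k l - k M - i) j (M - 1) (a - i)
        else 0 := by
  classical
  rw [weightedBetti_reliabilityIdeal, weightedBetti_reliabilityIdeal,
    ← Finset.sum_fiberwise_of_maps_to (t := (Finset.univ : Finset (Fin n)).powerset)
      (g := fun ν => Finset.univ.filter fun c => ν c = M) (fun ν _ => by simp)]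
  set F : ℕ → ℝ := fun s => levelProb P M ^ s * if k M ≤ s ∧ s - k M ≤ a then
        ((s - 1).choose (k M - 1) : ℝ) *
          weightedQuotientBetti K P (n - s) (fun l => k l - s) j (M - 1)
            (a - (s - k M)) else 0 with hF
  have hF0 : ∀ s, s < k M → F s = 0 := by
    intro s hs
    simp only [hF]
    rw [if_neg (by omega), mul_zero]
  have hempty : ∑ ν ∈ degreeBox n (M + 1) with (Finset.univ.filter fun c => ν c = M) = ∅,
        (reliabilityBetti K k j M ν a : ℝ) * monomialProb P ν =
      ∑ ν ∈ degreeBox n (M - 1 + 1),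
        (reliabilityBetti K k j (M - 1) ν a : ℝ) * monomialProb P ν := by
    have hset : (degreeBox n (M + 1)).filter
        (fun ν => (Finset.univ.filter fun c => ν c = M) = ∅) = degreeBox n (M - 1 + 1) := by
      ext ν
      rw [Finset.mem_filter, mem_degreeBox, mem_degreeBox, Finset.filter_eq_empty_iff]
      constructor
      · rintro ⟨h1, h2⟩ c
        have h3 := h1 c
        have h4 := h2 (Finset.mem_univ c)
        omega
      · intro h
        refine ⟨fun c => ?_, fun c _ => ?_⟩ <;> have := h c <;> omega
    rw [hset]
    refine Finset.sum_congr rfl fun ν hν => ?_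
    rw [mem_degreeBox] at hν
    rw [reliabilityBetti_pred hM hkM fun c => by have := hν c; omega]
  have hsplit : ∀ A ∈ (Finset.univ : Finset (Fin n)).powerset,
      ∑ ν ∈ degreeBox n (M + 1) with (Finset.univ.filter fun c => ν c = M) = A,
        (reliabilityBetti K k j M ν a : ℝ) * monomialProb P ν =
      (if A = ∅ then ∑ ν ∈ degreeBox n (M - 1 + 1),
        (reliabilityBetti K k j (M - 1) ν a : ℝ) * monomialProb P ν else 0) + F A.card := by
    intro A _
    by_cases hA : A = ∅
    · rw [if_pos hA, hA, Finset.card_empty, hF0 0 hkM, add_zero, hempty]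
    · rw [if_neg hA, zero_add,
        sum_top_eq hM hjM hkM P a (Finset.nonempty_iff_ne_empty.2 hA)]
  rw [Finset.sum_congr rfl hsplit, Finset.sum_add_distrib, Finset.sum_ite_eq',
    if_pos (Finset.empty_mem_powerset _), Finset.sum_powerset_apply_card, Finset.card_univ,
    Fintype.card_fin]
  congr 1
  have hsub : ∑ s ∈ Finset.Ico (k M) (n + 1), n.choose s • F s =
      ∑ s ∈ Finset.range (n + 1), n.choose s • F s := by
    refine Finset.sum_subset (fun s hs => ?_) fun s hs hs2 => ?_
    · rw [Finset.mem_Ico] at hs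
      exact Finset.mem_range.2 hs.2
    · rw [Finset.mem_range] at hs
      rw [Finset.mem_Ico] at hs2
      rw [hF0 s (by omega), smul_zero]
  rw [← hsub, Finset.sum_Ico_eq_sum_range]
  refine Finset.sum_congr rfl fun i _ => ?_
  simp only [hF, nsmul_eq_mul]
  rw [mul_assoc]
  congr 2
  have e1 : k M + i - k M = i := by omega
  have e2 : k M + i - 1 = i + k M - 1 := by omega
  have e3 : n - (k M + i) = n - k M - i := by omega
  have e4 : (fun l => k l - (k M + i)) = fun l => k l - k M - i := by
    funext l; omega
  rw [e1, e2, e3, e4]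
  simp

/-! ### Betti numbers of the quotient ring in degrees zero, one and higher -/

theorem monomialProb_zero (P : Measure ℕ) [IsProbabilityMeasure P] :
    monomialProb P (0 : Fin n → ℕ) = 1 := by
  have : Set.Ici 0 = (Set.univ : Set ℕ) := by ext; simp
  simp [monomialProb, levelProb, this]

theorem zero_mem_degreeBox (N : ℕ) : (0 : Fin n → ℕ) ∈ degreeBox n (N + 1) :=
  mem_degreeBox.2 fun _ => Nat.succ_pos N

theorem reliable_zero_iff (hj : 1 ≤ j) :
    Reliable k j M (0 : Fin n → ℕ) ↔ ∃ l ∈ Finset.Icc j M, k l = 0 := by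
  refine exists_congr fun l => and_congr_right fun hl => ?_
  have h1 := (Finset.mem_Icc.1 hl).1
  have : (Finset.univ.filter fun c : Fin n => l ≤ (0 : Fin n → ℕ) c) = ∅ := by
    refine Finset.filter_eq_empty_iff.2 fun c _ => ?_
    simp only [Pi.zero_apply]
    omega
  rw [this, Finset.card_empty, Nat.le_zero]

/-- The quotient has the single generator `1`, of probability one, unless some threshold is `0` and
the ideal is the whole ring. The indicator `ε` of the formula originates here and in degree one. -/
theorem weightedQuotientBetti_zero (hj : 1 ≤ j) (P : Measure ℕ) [IsProbabilityMeasure P] :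
    weightedQuotientBetti K P n k j M 0 = if ∀ l ∈ Finset.Icc j M, 0 < k l then 1 else 0 := by
  classical
  rw [weightedQuotientBetti, Finset.sum_eq_single (0 : Fin n → ℕ)]
  · rw [monomialProb_zero, mul_one, quotientBetti, if_pos rfl, reliable_zero_iff hj]
    by_cases h : ∀ l ∈ Finset.Icc j M, 0 < k l
    · rw [if_pos h, if_pos]
      · simp
      · refine ⟨rfl, ?_⟩
        rintro ⟨l, hl, h0⟩
        have := h l hl
        omega
    · rw [if_neg h, if_neg]
      · simp
      · push Not at h
        obtain ⟨l, hl, h0⟩ := h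
        exact fun h2 => h2.2 ⟨l, hl, Nat.le_zero.1 h0⟩
  · intro ν _ hν
    simp [quotientBetti, hν]
  · intro h
    exact absurd (zero_mem_degreeBox M) h

theorem koszulFace_empty {ν : Fin n → ℕ} : koszulFace k j M ν ∅ ↔ Reliable k j M ν := by
  rw [koszulFace, lower_empty]
  simp

theorem reliabilityBetti_eq_zero_of_not_reliable {ν : Fin n → ℕ} (h : ¬ Reliable k j M ν)
    (a : ℕ) : reliabilityBetti K k j M ν a = 0 := by
  rw [reliabilityBetti_eq]
  exact homDim_simplicial_eq_zero_of_not_empty koszulFace_down (koszulFace_empty.not.2 h) a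

theorem reliabilityBetti_of_minimal {ν : Fin n → ℕ} (h : Reliable k j M ν)
    (h1 : ∀ c, 0 < ν c → ¬ Reliable k j M (lower ν {c})) (a : ℕ) :
    reliabilityBetti K k j M ν a = if a = 0 then 1 else 0 := by
  rw [reliabilityBetti_eq]
  exact homDim_simplicial_of_no_vertex koszulFace_down (koszulFace_empty.2 h)
    (fun c hc => h1 c (hc.1 c (Finset.mem_singleton_self c)) hc.2) a

theorem reliabilityBetti_zero_of_lower {ν : Fin n → ℕ} {c : Fin n} (hc : 0 < ν c)
    (h : Reliable k j M (lower ν {c})) : reliabilityBetti K k j M ν 0 = 0 := by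
  rw [reliabilityBetti_eq]
  refine homDim_simplicial_zero koszulFace_down (c := c) ⟨fun x hx => ?_, h⟩
  rwa [Finset.mem_singleton.1 hx]

theorem reliabilityBetti_zero_succ (a : ℕ) :
    reliabilityBetti K k j M (0 : Fin n → ℕ) (a + 1) = 0 := by
  by_cases h : Reliable k j M (0 : Fin n → ℕ)
  · rw [reliabilityBetti_of_minimal h (fun c hc => absurd hc (lt_irrefl 0)),
      if_neg (Nat.succ_ne_zero a)]
  · exact reliabilityBetti_eq_zero_of_not_reliable h _

/-- Only degree `ν = 0` needs care; there both sides vanish, since even the unit ideal has nothing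
beyond its generator. -/
theorem weightedQuotientBetti_add_two (P : Measure ℕ) (t : ℕ) :
    weightedQuotientBetti K P n k j M (t + 2) =
      weightedBetti P (reliabilityIdeal K n k j M) (t + 1) := by
  rw [weightedQuotientBetti, weightedBetti_reliabilityIdeal]
  refine Finset.sum_congr rfl fun ν _ => ?_
  congr 2
  unfold quotientBetti
  by_cases h : ν = 0
  · subst h
    rw [if_pos rfl, if_neg (fun h => by omega), reliabilityBetti_zero_succ]
  · rw [if_neg h, if_neg (by omega)]
    rfl

/-- On at most one vertex a Koszul complex is void, `{∅}`, or a cone. This justifies the upper limit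
of the first sum in the formula. -/
theorem weightedBetti_succ_of_le_one (hn : n ≤ 1) (P : Measure ℕ) (a : ℕ) :
    weightedBetti P (reliabilityIdeal K n k j M) (a + 1) = 0 := by
  rw [weightedBetti_reliabilityIdeal]
  refine Finset.sum_eq_zero fun ν _ => ?_
  have : reliabilityBetti K k j M ν (a + 1) = 0 := by
    have hsub : Subsingleton (Fin n) := Fin.subsingleton_iff_le_one.2 hn
    by_cases h : Reliable k j M ν
    · by_cases h1 : ∃ c, koszulFace k j M ν {c}
      · obtain ⟨c, hc⟩ := h1
        rw [reliabilityBetti_eq]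
        refine homDim_simplicial_eq_zero_of_cone koszulFace_down (a := c) (fun τ hτ _ => ?_) _
        have : τ = ∅ := by
          rw [Finset.eq_empty_iff_forall_notMem]
          intro x hx
          rw [Subsingleton.elim x c] at hx
          exact hτ hx
        rw [this]
        exact hc
      · rw [reliabilityBetti_of_minimal h, if_neg (Nat.succ_ne_zero a)]
        intro c hc h2
        refine h1 ⟨c, fun x hx => ?_, h2⟩
        rwa [Finset.mem_singleton.1 hx]
    · exact reliabilityBetti_eq_zero_of_not_reliable h _
  rw [this, Int.cast_zero, zero_mul]

/-- The exponent of the generator `∏_{c ∈ σ} x_c ^ l`. -/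
def generatorDegree (p : (_ : ℕ) × Finset (Fin n)) (c : Fin n) : ℕ := if c ∈ p.2 then p.1 else 0

/-- The levels and supports of the generators. -/
def generatorIndex (n : ℕ) (k : ℕ → ℕ) (j M : ℕ) : Finset ((_ : ℕ) × Finset (Fin n)) :=
  (Finset.Icc j M).sigma fun l => Finset.powersetCard (k l) Finset.univ

theorem mem_generatorIndex {p : (_ : ℕ) × Finset (Fin n)} :
    p ∈ generatorIndex n k j M ↔ (j ≤ p.1 ∧ p.1 ≤ M) ∧ p.2.card = k p.1 := by
  simp [generatorIndex, Finset.mem_powersetCard]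

theorem reliable_generatorDegree {p : (_ : ℕ) × Finset (Fin n)} (hp : p ∈ generatorIndex n k j M) :
    Reliable k j M (generatorDegree p) := by
  obtain ⟨h1, h2⟩ := mem_generatorIndex.1 hp
  refine ⟨p.1, Finset.mem_Icc.2 h1, h2 ▸ Finset.card_le_card fun c hc => ?_⟩
  rw [Finset.mem_filter, generatorDegree, if_pos hc]
  exact ⟨Finset.mem_univ c, le_rfl⟩

/-- Below the level of the generator the thresholds exceed the size of its support, at that level
one component has been lost, and above it no component passes. The generators are therefore minimal.
-/
theorem not_reliable_lower_generatorDegree (hj : 1 ≤ j) (hpos : ∀ l ∈ Finset.Icc j M, 0 < k l)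
    (hk : StrictAntiOn k (Set.Icc j M)) {p : (_ : ℕ) × Finset (Fin n)}
    (hp : p ∈ generatorIndex n k j M) {c : Fin n} (hc : 0 < generatorDegree p c) :
    ¬ Reliable k j M (lower (generatorDegree p) {c}) := by
  obtain ⟨⟨h1, h2⟩, h3⟩ := mem_generatorIndex.1 hp
  rintro ⟨l, hl, hcard⟩
  obtain ⟨hl1, hl2⟩ := Finset.mem_Icc.1 hl
  have hcp : c ∈ p.2 := by
    by_contra h
    simp [generatorDegree, h] at hc
  have hsub : (Finset.univ.filter fun x => l ≤ lower (generatorDegree p) {c} x) ⊆ p.2 := by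
    intro x hx
    rw [Finset.mem_filter] at hx
    by_contra h
    have h4 := hx.2.trans (lower_le (generatorDegree p) {c} x)
    rw [generatorDegree, if_neg h] at h4
    omega
  rcases lt_trichotomy l p.1 with h | h | h
  · have h4 := hk ⟨hl1, hl2⟩ ⟨h1, h2⟩ h
    have h5 := Finset.card_le_card hsub
    omega
  · have hsub2 : (Finset.univ.filter fun x => l ≤ lower (generatorDegree p) {c} x) ⊆
        p.2.erase c := by
      intro x hx
      refine Finset.mem_erase.2 ⟨?_, hsub hx⟩
      rintro rfl
      rw [Finset.mem_filter] at hx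
      have h4 := hx.2
      rw [lower, if_pos (Finset.mem_singleton_self x), generatorDegree, if_pos hcp] at h4
      omega
    have h4 := Finset.card_le_card hsub2
    rw [Finset.card_erase_of_mem hcp] at h4
    have h5 := hpos l hl
    rw [h] at hcard h5
    rw [h] at h4
    omega
  · have hempty : (Finset.univ.filter fun x => l ≤ lower (generatorDegree p) {c} x) = ∅ := by
      refine Finset.filter_eq_empty_iff.2 fun x _ hx => ?_
      have h4 := hx.trans (lower_le (generatorDegree p) {c} x)
      unfold generatorDegree at h4
      split_ifs at h4 <;> omega
    rw [hempty, Finset.card_empty] at hcard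
    have := hpos l hl
    omega

theorem exists_generatorDegree_le {ν : Fin n → ℕ} (h : Reliable k j M ν) :
    ∃ p ∈ generatorIndex n k j M, generatorDegree p ≤ ν := by
  obtain ⟨l, hl, hcard⟩ := h
  obtain ⟨σ, hσ, hc⟩ := Finset.exists_subset_card_eq hcard
  refine ⟨⟨l, σ⟩, mem_generatorIndex.2 ⟨Finset.mem_Icc.1 hl, hc⟩, fun c => ?_⟩
  unfold generatorDegree
  split_ifs with h
  · exact (Finset.mem_filter.1 (hσ h)).2
  · exact Nat.zero_le _

/-- A monomial properly divisible by a generator stays in the ideal after lowering some entry, so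
its Koszul complex has a vertex. -/
theorem reliabilityBetti_zero_of_ne {ν : Fin n → ℕ}
    (hν : ∀ p ∈ generatorIndex n k j M, generatorDegree p ≠ ν) :
    reliabilityBetti K k j M ν 0 = 0 := by
  by_cases h : Reliable k j M ν
  · obtain ⟨p, hp, hle⟩ := exists_generatorDegree_le h
    obtain ⟨c, hc⟩ : ∃ c, generatorDegree p c < ν c := by
      by_contra! h2
      exact hν p hp (le_antisymm hle h2)
    refine reliabilityBetti_zero_of_lower (c := c) (Nat.zero_lt_of_lt hc)
      ((reliable_generatorDegree hp).mono _ _ fun x => ?_)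
    unfold lower
    split_ifs with hx
    · rw [Finset.mem_singleton.1 hx]
      exact Nat.le_sub_one_of_lt hc
    · exact hle x
  · exact reliabilityBetti_eq_zero_of_not_reliable h _

/-- Positive levels let the support be recovered from the exponent, and positive thresholds make it
nonempty, so the level is recovered too. -/
theorem generatorDegree_injOn (hj : 1 ≤ j) (hpos : ∀ l ∈ Finset.Icc j M, 0 < k l) :
    Set.InjOn (generatorDegree (n := n)) (generatorIndex n k j M) := by
  have hsupp : ∀ p ∈ generatorIndex n k j M, ∀ c, c ∈ p.2 ↔ generatorDegree p c ≠ 0 := by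
    intro p hp c
    have := (mem_generatorIndex.1 hp).1.1
    unfold generatorDegree
    split_ifs with h
    · simp only [h, true_iff]; omega
    · simp [h]
  rintro ⟨l, σ⟩ hp ⟨l', σ'⟩ hp' h
  have hσ : σ = σ' := by
    ext c
    rw [hsupp _ hp, hsupp _ hp', h]
  subst hσ
  obtain ⟨hl, hcard⟩ := mem_generatorIndex.1 hp
  have h1 := hpos l (Finset.mem_Icc.2 hl)
  obtain ⟨c, hc⟩ := Finset.card_pos.1 (by simp only at hcard; omega : 0 < σ.card)
  have h2 := congrFun h c
  simp only [generatorDegree, hc, if_true] at h2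
  rw [h2]

theorem monomialProb_generatorDegree (P : Measure ℕ) [IsProbabilityMeasure P]
    (p : (_ : ℕ) × Finset (Fin n)) :
    monomialProb P (generatorDegree p) = levelProb P p.1 ^ p.2.card := by
  have h0 : levelProb P 0 = 1 := by
    have : Set.Ici 0 = (Set.univ : Set ℕ) := by ext; simp
    simp [levelProb, this]
  unfold monomialProb generatorDegree
  rw [← Finset.prod_const, ← Finset.prod_subset (Finset.subset_univ p.2)]
  · exact Finset.prod_congr rfl fun c hc => by rw [if_pos hc]
  · intro c _ hc
    rw [if_neg hc, h0]

/-- For a proper ideal this counts minimal generators. For the whole ring the only generator is in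
degree `0`, which the quotient omits. Strict decrease is assumed only under positivity because
truncated thresholds may coincide at `0`. -/
theorem weightedQuotientBetti_one (hj : 1 ≤ j) (hk : (∀ l ∈ Finset.Icc j M, 0 < k l) →
    StrictAntiOn k (Set.Icc j M)) (P : Measure ℕ) [IsProbabilityMeasure P] :
    weightedQuotientBetti K P n k j M 1 = if ∀ l ∈ Finset.Icc j M, 0 < k l then
      ∑ l ∈ Finset.Icc j M, (n.choose (k l) : ℝ) * levelProb P l ^ k l else 0 := by
  classical
  have hq : ∀ ν : Fin n → ℕ, quotientBetti K k j M ν 1 =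
      if ν = 0 then 0 else reliabilityBetti K k j M ν 0 := by
    intro ν
    unfold quotientBetti
    split_ifs <;> simp_all
  rw [weightedQuotientBetti]
  split_ifs with hpos
  · have hq' : ∀ ν : Fin n → ℕ, quotientBetti K k j M ν 1 = reliabilityBetti K k j M ν 0 := by
      intro ν
      rw [hq]
      split_ifs with h
      · subst h
        rw [reliabilityBetti_eq_zero_of_not_reliable]
        rw [reliable_zero_iff hj]
        rintro ⟨l, hl, h0⟩
        have := hpos l hl
        omega
      · rfl
    simp only [hq']
    have himg : ∑ ν ∈ (generatorIndex n k j M).image generatorDegree,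
        (reliabilityBetti K k j M ν 0 : ℝ) * monomialProb P ν =
        ∑ ν ∈ degreeBox n (M + 1), (reliabilityBetti K k j M ν 0 : ℝ) * monomialProb P ν := by
      refine Finset.sum_subset (fun ν hν => ?_) fun ν _ hν => ?_
      · obtain ⟨p, hp, rfl⟩ := Finset.mem_image.1 hν
        rw [mem_degreeBox]
        intro c
        have := (mem_generatorIndex.1 hp).1.2
        unfold generatorDegree
        split_ifs <;> omega
      · rw [reliabilityBetti_zero_of_ne, Int.cast_zero, zero_mul]
        intro p hp h
        exact hν (Finset.mem_image.2 ⟨p, hp, h⟩)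
    rw [← himg, Finset.sum_image (generatorDegree_injOn hj hpos), generatorIndex,
      Finset.sum_sigma]
    refine Finset.sum_congr rfl fun l hl => ?_
    have hterm : ∀ σ ∈ Finset.powersetCard (k l) (Finset.univ : Finset (Fin n)),
        (reliabilityBetti K k j M (generatorDegree ⟨l, σ⟩) 0 : ℝ) *
          monomialProb P (generatorDegree ⟨l, σ⟩) = levelProb P l ^ k l := by
      intro σ hσ
      have hp : (⟨l, σ⟩ : (_ : ℕ) × Finset (Fin n)) ∈ generatorIndex n k j M :=
        Finset.mem_sigma.2 ⟨hl, hσ⟩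
      rw [reliabilityBetti_of_minimal (reliable_generatorDegree hp) fun c hc =>
        not_reliable_lower_generatorDegree hj hpos (hk hpos) hp hc, if_pos rfl, Int.cast_one,
        one_mul, monomialProb_generatorDegree, (Finset.mem_powersetCard.1 hσ).2]
    rw [Finset.sum_congr rfl hterm, Finset.sum_const, Finset.card_powersetCard, Finset.card_univ,
      Fintype.card_fin, nsmul_eq_mul]
  · have hrel : Reliable k j M (0 : Fin n → ℕ) := by
      rw [reliable_zero_iff hj]
      push Not at hpos
      obtain ⟨l, hl, h0⟩ := hpos
      exact ⟨l, hl, Nat.le_zero.1 h0⟩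
    refine Finset.sum_eq_zero fun ν _ => ?_
    rw [hq]
    split_ifs with h
    · simp
    · obtain ⟨c, hc⟩ : ∃ c, ν c ≠ 0 := Function.ne_iff.1 h
      rw [reliabilityBetti_zero_of_lower (Nat.pos_of_ne_zero hc)
        (hrel.mono _ _ fun _ => Nat.zero_le _), Int.cast_zero, zero_mul]

/-- The subset-of-a-subset identity pulls the factor depending on `α` out of each summand, and what
remains is a hockey-stick sum. -/
theorem sum_choose_mul_choose (q α N : ℕ) :
    ∑ i ∈ Finset.range N, (i + q).choose q * i.choose α =
      (N + q).choose (q + 1 + α) * (α + q).choose q := by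
  induction N with
  | zero => simp [Nat.choose_eq_zero_of_lt (show q < q + 1 + α by omega)]
  | succ N ih =>
    have h1 : (N + q).choose q * N.choose α = (N + q).choose (q + α) * (α + q).choose q := by
      by_cases h : α ≤ N
      · have := Nat.choose_mul (n := N + q) (k := q + α) (s := q) (by omega)
        rw [Nat.add_sub_cancel, Nat.add_sub_cancel_left] at this
        rw [← this, Nat.add_comm α q]
      · rw [Nat.choose_eq_zero_of_lt (show N < α by omega),
          Nat.choose_eq_zero_of_lt (show N + q < q + α by omega)]
        simp
    have h2 : (N + 1 + q).choose (q + 1 + α) =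
        (N + q).choose (q + α) + (N + q).choose (q + 1 + α) := by
      rw [show N + 1 + q = (N + q) + 1 by omega, show q + 1 + α = (q + α) + 1 by omega,
        Nat.choose_succ_succ]
    rw [Finset.sum_range_succ, ih, h1, h2]
    ring

end Weighted

end MultiState

/-! ### Assembly of the recursion -/

theorem mainTheorem5 (K : Type*) [Field K] (P : MeasureTheory.Measure ℕ)
    [MeasureTheory.IsProbabilityMeasure P] (n j M : ℕ) (hj : 1 ≤ j) (hjM : j ≤ M)
    (k : ℕ → ℕ) (hk : StrictAntiOn k (Set.Icc j M)) (hkM : 1 ≤ k M) (α : ℕ) :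
    MultiState.weightedBetti P (MultiState.reliabilityIdeal K n k j M) α =
      MultiState.weightedBetti P (MultiState.reliabilityIdeal K n k j (M - 1)) α
      + ∑ i ∈ Finset.range (n - k M - 1) with i + 2 ≤ α,
          (n.choose (k M + i) : ℝ) * ((i + k M - 1).choose (k M - 1) : ℝ)
            * MultiState.levelProb P M ^ (k M + i)
            * MultiState.weightedBetti P
                (MultiState.reliabilityIdeal K (n - k M - i) (fun l => k l - k M - i) j (M - 1))
                (α - i - 1)
      + (if 1 ≤ α ∧ ∀ l ∈ Finset.Ico j M, k M + (α - 1) < k l then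
          (n.choose (k M + α - 1) : ℝ) * ((α + k M - 2).choose (k M - 1) : ℝ)
            * MultiState.levelProb P M ^ (k M + α - 1)
            * ∑ l ∈ Finset.Ico j M,
                ((n - k M - (α - 1)).choose (k l - k M - (α - 1)) : ℝ)
                  * MultiState.levelProb P l ^ (k l - k M - (α - 1))
        else 0)
      + (if ∀ l ∈ Finset.Ico j M, k M + α < k l then
          MultiState.levelProb P M ^ (k M + α)
            * ∑ i ∈ Finset.range (n + 1 - k M),
                ((i + k M - 1).choose (k M - 1) : ℝ) * (i.choose α : ℝ)
        else 0) := by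
  have hM : 1 ≤ M := hj.trans hjM
  -- As `M` is positive, the truncated `M - 1` is harmless; for `M = j` both intervals are empty and
  -- the truncated ideal is zero.
  have hIcc : Finset.Icc j (M - 1) = Finset.Ico j M := by
    ext l
    rw [Finset.mem_Icc, Finset.mem_Ico]
    omega
  have hpos : ∀ i, (∀ l ∈ Finset.Icc j (M - 1), 0 < k l - k M - i) ↔
      ∀ l ∈ Finset.Ico j M, k M + i < k l := by
    intro i
    rw [hIcc]
    refine forall₂_congr fun l _ => ?_
    omega
  have hanti : ∀ i, (∀ l ∈ Finset.Icc j (M - 1), 0 < k l - k M - i) →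
      StrictAntiOn (fun l => k l - k M - i) (Set.Icc j (M - 1)) := by
    intro i h l hl l' hl' hlt
    have h1 := hk ⟨hl.1, by have := hl.2; omega⟩ ⟨hl'.1, by have := hl'.2; omega⟩ hlt
    have h2 := h l' (Finset.mem_Icc.2 hl')
    simp only
    omega
  rw [MultiState.weightedBetti_recursion hM hjM hkM, add_assoc, add_assoc]
  congr 1
  set T : ℕ → ℝ := fun i => (n.choose (k M + i) : ℝ) * MultiState.levelProb P M ^ (k M + i) *
        if i ≤ α then ((i + k M - 1).choose (k M - 1) : ℝ) *
          MultiState.weightedQuotientBetti K P (n - k M - i) (fun l => k l - k M - i) j (M - 1)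
            (α - i) else 0 with hT
  have hTzero : ∀ i, n + 1 - k M ≤ i → T i = 0 := by
    intro i hi
    simp only [hT]
    rw [Nat.choose_eq_zero_of_lt (by omega), Nat.cast_zero, zero_mul, zero_mul]
  -- The three pieces are the quotient degrees `α - i ≥ 2`, `α - i = 1` and `α - i = 0`.
  have hsplit : ∀ i, T i = (if i + 2 ≤ α then T i else 0) + ((if i + 1 = α then T i else 0) +
      if i = α then T i else 0) := by
    intro i
    rcases lt_trichotomy i α with h | h | h
    · by_cases h2 : i + 1 = α
      · rw [if_neg (by omega), if_pos h2, if_neg (by omega)]; ring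
      · rw [if_pos (by omega), if_neg h2, if_neg (by omega)]; ring
    · rw [if_neg (by omega), if_neg (by omega), if_pos h]; ring
    · have : T i = 0 := by
        simp only [hT]
        rw [if_neg (by omega), mul_zero]
      rw [this]
      simp
  rw [Finset.sum_congr rfl fun i _ => hsplit i, Finset.sum_add_distrib, Finset.sum_add_distrib]
  congr 1
  · rw [← Finset.sum_filter]
    have hsub : (Finset.range (n - k M - 1)).filter (fun i => i + 2 ≤ α) ⊆
        (Finset.range (n + 1 - k M)).filter (fun i => i + 2 ≤ α) :=
      Finset.filter_subset_filter _ (Finset.range_subset_range.2 (by omega))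
    rw [← Finset.sum_subset hsub]
    · refine Finset.sum_congr rfl fun i hi => ?_
      have h2 := (Finset.mem_filter.1 hi).2
      obtain ⟨t, rfl⟩ : ∃ t, α = i + (t + 2) := ⟨α - i - 2, by omega⟩
      simp only [hT]
      rw [if_pos (by omega), Nat.add_sub_cancel_left, MultiState.weightedQuotientBetti_add_two]
      have h3 : t + 2 - 1 = t + 1 := rfl
      rw [h3]
      ring
    -- The additional indices leave at most one variable, where higher Betti numbers vanish.
    · intro i hi hi2
      have h2 := (Finset.mem_filter.1 hi).2
      have h4 : ¬ i < n - k M - 1 := fun h =>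
        hi2 (Finset.mem_filter.2 ⟨Finset.mem_range.2 h, h2⟩)
      obtain ⟨t, rfl⟩ : ∃ t, α = i + (t + 2) := ⟨α - i - 2, by omega⟩
      simp only [hT]
      rw [if_pos (by omega), Nat.add_sub_cancel_left, MultiState.weightedQuotientBetti_add_two,
        MultiState.weightedBetti_succ_of_le_one (by omega), mul_zero, mul_zero]
  congr 1
  · cases α with
    | zero => simp
    | succ β =>
      have h1 : ∑ i ∈ Finset.range (n + 1 - k M), (if i + 1 = β + 1 then T i else 0) = T β := by
        simp only [Nat.add_right_cancel_iff]
        rw [Finset.sum_ite_eq']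
        split_ifs with h
        · rfl
        · rw [hTzero β (by simpa using h)]
      rw [h1]
      simp only [hT]
      rw [if_pos (Nat.le_succ β), Nat.add_sub_cancel_left,
        MultiState.weightedQuotientBetti_one hj (hanti β), Nat.add_sub_cancel]
      have h2 : k M + (β + 1) - 1 = k M + β := by omega
      have h3 : β + 1 + k M - 2 = β + k M - 1 := by omega
      rw [h2, h3]
      by_cases h : ∀ l ∈ Finset.Ico j M, k M + β < k l
      · rw [if_pos ((hpos β).2 h), if_pos ⟨by omega, h⟩, hIcc]
        ring
      · rw [if_neg ((hpos β).not.2 h), if_neg fun h4 => h h4.2]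
        ring
  · have h1 : ∑ i ∈ Finset.range (n + 1 - k M), (if i = α then T i else 0) = T α := by
      rw [Finset.sum_ite_eq']
      split_ifs with h
      · rfl
      · rw [hTzero α (by simpa using h)]
    rw [h1]
    simp only [hT]
    rw [if_pos le_rfl, Nat.sub_self, MultiState.weightedQuotientBetti_zero hj]
    by_cases h : ∀ l ∈ Finset.Ico j M, k M + α < k l
    · rw [if_pos ((hpos α).2 h), if_pos h]
      obtain ⟨q, hq⟩ : ∃ q, k M = q + 1 := ⟨k M - 1, by omega⟩
      have h2 := MultiState.sum_choose_mul_choose q α (n + 1 - k M)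
      -- For `k M > n` the truncated difference is `0`, and both binomials vanish.
      have h3 : (n + 1 - k M + q).choose (q + 1 + α) = n.choose (k M + α) := by
        by_cases hn : k M ≤ n
        · congr 1 <;> omega
        · rw [Nat.choose_eq_zero_of_lt (by omega), Nat.choose_eq_zero_of_lt (by omega)]
      rw [h3] at h2
      have h4 : ∀ i, i + k M - 1 = i + q := fun i => by omega
      have h5 : k M - 1 = q := by omega
      simp only [h4, h5]
      have h6 : (∑ i ∈ Finset.range (n + 1 - k M), ((i + q).choose q : ℝ) * (i.choose α : ℝ)) =
          (n.choose (k M + α) : ℝ) * ((α + q).choose q : ℝ) := by exact_mod_cast h2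
      rw [h6]
      ring
    · rw [if_neg ((hpos α).not.2 h), if_neg h]
      ring
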